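/- A binary string (1 = detection, 0 = non-detection) is \emph{tracking} if it contains a block of at most 5 consecutive characters with at least three 1s in which no two consecutive 0s lie between 1s of the block; otherwise it is \emph{non-tracking}. Let $NTr(k)$ be the number of non-tracking strings of length $k$. An \emph{initial-loss} non-tracking string is a non-tracking string with no 1 in the first or the second place. A tournament is \emph{unique} if every tournament on the same number of vertices with the same score vector (multiset of numbers of wins) is isomorphic to it. Let $UT(k)$ be the number of unique tournaments on $k$ vertices up to isomorphism (OEIS A000570). The composition $A+B$ of two tournaments is their disjoint union in which, in addition, every vertex of $B$ wins against every vertex of $A$. There are four basic tournaments, with score vectors $\{0\}$, $\{1,1,1\}$, $\{1,1,2,2\}$, $\{2,2,2,2,2\}$. Then: (1) $NTr(k)=UT(k+2)$ for every $k\ge 0$. (2) The basic tournaments are unique, and every unique tournament is isomorphic to the composition of exactly one finite sequence of basic tournaments. (3) The composition of two unique tournaments is unique, and there is exactly one family of bijections $\varphi_k$ ($k\ge 0$), from the set of isomorphism classes of unique tournaments on $k$ vertices onto the set of initial-loss non-tracking strings of length $k$, that sends the basic tournaments with score vectors $\{0\}$, $\{1,1,1\}$, $\{1,1,2,2\}$,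 $\{2,2,2,2,2\}$ to the strings $0$, $001$, $0011$, $00101$ respectively and satisfies $\varphi_{m+n}(A+B)=\varphi_m(A)\varphi_n(B)$ (concatenation) for all unique tournaments $A$ on $m$ vertices and $B$ on $n$ vertices. (Hence $\varphi_k$ is explicit: decompose a unique tournament into basic ones and concatenate the corresponding basic strings.) -/

import Mathlib

/-! ### Binary strings and the tracking rule "3 out of 5 with loss 2"

`true` stands for the character `1` (a detection), `false` for `0` (a non-detection). -/

/-- A string establishes a track if some block `w` of at most five consecutive observations holds
at least three detections, and `w` has no two non-detections in a row lying between detections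
of `w`. -/
def IsTracking (s : List Bool) : Prop :=
  ∃ w : List Bool, w <:+: s ∧ w.length ≤ 5 ∧ 3 ≤ w.count true ∧
    ∀ a b : List Bool, w = a ++ [false, false] ++ b → ¬ (true ∈ a ∧ true ∈ b)

/-- The number of non-tracking strings of length `k`. -/
noncomputable def NTr (k : ℕ) : ℕ :=
  Nat.card {s : List Bool // s.length = k ∧ ¬ IsTracking s}

/-- A string has an initial loss if it has no `1` in the first or in the second place. -/
def IsInitialLoss (s : List Bool) : Prop :=
  s[0]? ≠ some true ∧ s[1]? ≠ some true

/-- The initial-loss non-tracking strings of length `k`. -/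
abbrev ILString (k : ℕ) : Type :=
  {s : List Bool // s.length = k ∧ IsInitialLoss s ∧ ¬ IsTracking s}

/-! ### Tournaments -/

/-- A tournament on `V`: an orientation of the complete graph on `V`. `Adj v w` means that `v`
wins against `w`. -/
structure Tournament (V : Type*) extends Digraph V where
  asymm : ∀ v w, Adj v w → ¬ Adj w v
  total : ∀ v w, v ≠ w → Adj v w ∨ Adj w v

namespace Tournament

/-- Two tournaments are isomorphic if some bijection of the vertices preserves all results. -/
def Iso {V W : Type*} (S : Tournament V) (T : Tournament W) : Prop :=
  Nonempty (S.Adj ≃r T.Adj)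

/-- The number of wins of `v`. -/
noncomputable def score {V : Type*} (T : Tournament V) (v : V) : ℕ :=
  {w | T.Adj v w}.ncard

/-- The score vector, the order of the participants being irrelevant. -/
noncomputable def scoreVector {V : Type*} [Fintype V] (T : Tournament V) : Multiset ℕ :=
  Finset.univ.val.map T.score

/-- A tournament is unique if its score vector determines it up to isomorphism. -/
def IsUnique {V : Type*} [Fintype V] (T : Tournament V) : Prop :=
  ∀ S : Tournament V, S.scoreVector = T.scoreVector → S.Iso T

/-- The composition `A + B`: both groups play among themselves as in `A` and in `B`, and everyone
in the second group wins against everyone in the first group. -/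
def sum {V W : Type*} (A : Tournament V) (B : Tournament W) : Tournament (V ⊕ W) where
  Adj
    | .inl v, .inl v' => A.Adj v v'
    | .inr w, .inr w' => B.Adj w w'
    | .inr _, .inl _ => True
    | .inl _, .inr _ => False
  asymm := by
    rintro (v | v) (w | w) h
    · exact A.asymm v w h
    · exact h.elim
    · exact id
    · exact B.asymm v w h
  total := by
    rintro (v | v) (w | w) h
    · exact A.total v w fun e => h (by rw [e])
    · exact Or.inr trivial
    · exact Or.inl trivial
    · exact B.total v w fun e => h (by rw [e])

/-- The tournament on `W` obtained from one on `V` by renaming the vertices. -/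
def relabel {V W : Type*} (e : V ≃ W) (T : Tournament V) : Tournament W where
  Adj w w' := T.Adj (e.symm w) (e.symm w')
  asymm _ _ h := T.asymm _ _ h
  total _ _ h := T.total _ _ fun he => h (e.symm.injective he)

/-- The composition of tournaments on `m` and on `n` vertices, as a tournament on `m + n`
vertices (the first `m` of them being the first group). -/
def compose {m n : ℕ} (A : Tournament (Fin m)) (B : Tournament (Fin n)) :
    Tournament (Fin (m + n)) :=
  (A.sum B).relabel finSumFinEquiv

end Tournament

/-- Isomorphism, as an equivalence relation on the unique tournaments with `k` vertices. -/
instance uniqueTournamentSetoid (k : ℕ) :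
    Setoid {T : Tournament (Fin k) // T.IsUnique} where
  r S T := S.1.Iso T.1
  iseqv :=
    { refl := fun S => ⟨RelIso.refl S.1.Adj⟩
      symm := fun ⟨e⟩ => ⟨e.symm⟩
      trans := fun ⟨e⟩ ⟨f⟩ => ⟨e.trans f⟩ }

/-- The unique tournaments with `k` vertices, up to isomorphism. -/
abbrev UniqueTournament (k : ℕ) : Type :=
  Quotient (uniqueTournamentSetoid k)

/-- The isomorphism class of a unique tournament. -/
def Tournament.IsUnique.toClass {k : ℕ} {T : Tournament (Fin k)} (h : T.IsUnique) :
    UniqueTournament k :=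
  Quotient.mk _ ⟨T, h⟩

/-- The number of unique tournaments with `k` vertices. -/
noncomputable def UT (k : ℕ) : ℕ :=
  Nat.card (UniqueTournament k)

/-! ### The four basic building blocks -/

/-- The four types of basic tournaments and of basic strings. -/
inductive Basic : Type
  | b1
  | b3
  | b4
  | b5

namespace Basic

/-- The number of vertices, which is also the length of the string. -/
def size : Basic → ℕ
  | b1 => 1
  | b3 => 3
  | b4 => 4
  | b5 => 5

/-- The basic strings `0`, `001`, `0011`, `00101`. -/
def string : Basic → List Bool
  | b1 => [false]
  | b3 => [false, false, true]
  | b4 => [false, false, true, true]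
  | b5 => [false, false, true, false, true]

/-- The score vectors of the basic tournaments. -/
def scores : Basic → Multiset ℕ
  | b1 => {0}
  | b3 => {1, 1, 1}
  | b4 => {1, 1, 2, 2}
  | b5 => {2, 2, 2, 2, 2}

/-- The basic tournaments. -/
def tournament : (b : Basic) → Tournament (Fin b.size)
  | b1 =>
    { Adj := fun _ _ => False
      asymm := fun _ _ h => h.elim
      total := fun (v w : Fin 1) h => (h (Subsingleton.elim v w)).elim }
  | b3 =>
    { Adj := fun v w : Fin 3 => w = v + 1
      asymm := by unfold size; decide
      total := by unfold size; decide }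
  | b4 =>
    { Adj := fun v w : Fin 4 => w = v + 1 ∨ (v = 0 ∧ w = 2) ∨ (v = 1 ∧ w = 3)
      asymm := by unfold size; decide
      total := by unfold size; decide }
  | b5 =>
    { Adj := fun v w : Fin 5 => w = v + 1 ∨ w = v + 2
      asymm := by unfold size; decide
      total := by unfold size; decide }

/-- The number of vertices of a composition of basic tournaments. -/
def totalSize : List Basic → ℕ
  | [] => 0
  | b :: l => b.size + totalSize l

/-- The composition of a list of basic tournaments, in the order of the list. -/
def composition : (l : List Basic) → Tournament (Fin (totalSize l))
  | [] =>
    { Adj := fun _ _ => False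
      asymm := fun _ _ h => h.elim
      total := fun v _ _ => Fin.elim0 v }
  | b :: l => b.tournament.compose (composition l)

end Basic

/-!
A tournament is unique exactly if it is a composition of basic tournaments, and an initial-loss
string is non-tracking exactly if it is a concatenation of basic strings. In both cases the sequence
of constituents is determined, so both sets are in bijection with the lists of basic types
(`Basic.existsUnique_iso_composition`, `Basic.encode_injective`, `Basic.exists_encode_eq`).

*Strings.* A string is tracking if and only if `111`, `1011`, `1101` or `10101` occurs in it
(`isTracking_iff`). Hence the `1`s of a non-tracking string come in groups `1`, `11`, `101` that are
separated by at least two zeros.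

*Compositions.* A set of `m` vertices always has `m * (m - 1) / 2` wins inside, so the scores alone
show that a group wins no game against the rest (`Tournament.eq_sum_of_score_eq`). Therefore a
composition is unique if and only if both of its parts are, and everything reduces to strong
unique tournaments.

*Strong unique tournaments.* Reversing a 3-cycle keeps all scores, so in a unique tournament it must
keep every isomorphism invariant. Two invariants are used. The sum of `score v * score w ^ 2` over
all results `v → w` excludes 3-cycles with three different scores
(`Tournament.IsUnique.not_rainbow`). The sum of the squares of the numbers of wins inside the own
score class shows that on a 3-cycle `x → y → z → x` with `score x = score y ≠ score z` the vertex `x`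
has just one more inner win than `y` (`Tournament.IsUnique.inner_eq_add_one`). So inside a class the
inner scores take at most two consecutive values, equally often if there are two, and vertices
that agree in score and inner score are not distinguished by vertices of other classes. Counting
then shows that the two classes on such a cycle have two vertices each, and that their union is a
module: no other vertex distinguishes its members (`Tournament.card_classes_of_cycle`). If there is
no such cycle, every class is a module. A proper module of a strong tournament lies on 3-cycles
with two outside vertices, which are impossible here. So a strong unique tournament is regular
or has just two classes of two vertices (`Tournament.IsStrong.score_eq_or_card_eq`); in the second
case the score vector is `{1, 1, 2, 2}`. A regular tournament with at least seven vertices is not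
unique, as the rotational tournament shows (`Tournament.IsUnique.lt_three_of_regular`).
-/

/-! ### Scores, relabelling and isomorphism -/

namespace Tournament

variable {U V W : Type*}

theorem not_adj_self (T : Tournament V) (v : V) : ¬ T.Adj v v := fun h => T.asymm v v h h

theorem ne_of_adj {T : Tournament V} {v w : V} (h : T.Adj v w) : v ≠ w := by
  rintro rfl
  exact T.not_adj_self v h

theorem adj_of_not_adj {T : Tournament V} {v w : V} (hne : v ≠ w) (h : ¬ T.Adj v w) :
    T.Adj w v :=
  (T.total v w hne).resolve_left h

theorem ext_adj {S T : Tournament V} (h : ∀ v w, S.Adj v w ↔ T.Adj v w) : S = T := by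
  obtain ⟨⟨A⟩, _, _⟩ := S
  obtain ⟨⟨B⟩, _, _⟩ := T
  obtain rfl : A = B := funext fun v => funext fun w => propext (h v w)
  rfl

theorem Iso.refl (T : Tournament V) : T.Iso T := ⟨RelIso.refl _⟩

theorem Iso.symm {S : Tournament V} {T : Tournament W} (h : S.Iso T) : T.Iso S :=
  h.elim fun e => ⟨e.symm⟩

theorem Iso.trans {R : Tournament U} {S : Tournament V} {T : Tournament W} (h : R.Iso S)
    (h' : S.Iso T) : R.Iso T :=
  h.elim fun e => h'.elim fun f => ⟨e.trans f⟩

theorem iso_relabel (T : Tournament V) (e : V ≃ W) : T.Iso (T.relabel e) :=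
  ⟨⟨e, by simp [relabel]⟩⟩

/-- A map that preserves results is injective, because distinct vertices have a result; between
tournaments of the same size it is therefore an isomorphism. -/
theorem iso_of_hom [Finite W] {S : Tournament V} {T : Tournament W} (f : V → W)
    (hf : ∀ v w, S.Adj v w → T.Adj (f v) (f w)) (hc : Nat.card W ≤ Nat.card V) : S.Iso T := by
  have hinj : Function.Injective f := by
    intro v w h
    by_contra hne
    rcases S.total v w hne with h' | h'
    · exact ne_of_adj (hf _ _ h') h
    · exact ne_of_adj (hf _ _ h') h.symm
  have : Finite V := Finite.of_injective f hinj
  have hbij : Function.Bijective f :=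
    (Nat.bijective_iff_injective_and_card f).2
      ⟨hinj, le_antisymm (Nat.card_le_card_of_injective f hinj) hc⟩
  refine ⟨⟨Equiv.ofBijective f hbij, ?_⟩⟩
  intro v w
  refine ⟨fun h => ?_, hf v w⟩
  by_contra hn
  have hne : v ≠ w := by
    rintro rfl
    exact T.not_adj_self _ h
  exact T.asymm _ _ h (hf _ _ (adj_of_not_adj hne hn))

/-- The tournament played by the vertices in the range of an injective map. -/
def comap (f : V → W) (hf : Function.Injective f) (T : Tournament W) : Tournament V where
  Adj v w := T.Adj (f v) (f w)
  asymm _ _ h := T.asymm _ _ h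
  total _ _ h := T.total _ _ fun he => h (hf he)

theorem sum_congr {V' W' : Type*} {A : Tournament V} {A' : Tournament V'} {B : Tournament W}
    {B' : Tournament W'} (hA : A.Iso A') (hB : B.Iso B') : (A.sum B).Iso (A'.sum B') := by
  obtain ⟨e⟩ := hA
  obtain ⟨f⟩ := hB
  refine ⟨⟨Equiv.sumCongr e.toEquiv f.toEquiv, ?_⟩⟩
  rintro (v | v) (w | w)
  · exact e.map_rel_iff
  · exact Iff.rfl
  · exact Iff.rfl
  · exact f.map_rel_iff

theorem sum_assoc {X : Type*} (A : Tournament V) (B : Tournament W) (C : Tournament X) :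
    ((A.sum B).sum C).Iso (A.sum (B.sum C)) := by
  refine ⟨⟨Equiv.sumAssoc V W X, ?_⟩⟩
  rintro ((v | v) | v) ((w | w) | w) <;> exact Iff.rfl

theorem sum_iso_of_isEmpty [IsEmpty V] (A : Tournament V) (B : Tournament W) :
    (A.sum B).Iso B := by
  refine ⟨⟨Equiv.emptySum V W, ?_⟩⟩
  rintro (v | v) (w | w)
  · exact isEmptyElim v
  · exact isEmptyElim v
  · exact isEmptyElim w
  · exact Iff.rfl

section Score

open scoped Classical in
theorem score_eq_sum [Fintype V] (T : Tournament V) (v : V) :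
    T.score v = ∑ w, if T.Adj v w then 1 else 0 := by
  rw [score, Set.ncard_eq_toFinset_card', Finset.sum_boole]
  simp

theorem score_lt_card [Fintype V] (T : Tournament V) (v : V) : T.score v < Fintype.card V := by
  rw [score, ← Nat.card_eq_fintype_card, ← Set.ncard_univ]
  refine Set.ncard_lt_ncard ?_
  rw [Set.ssubset_univ_iff]
  intro h
  exact T.not_adj_self v (h.symm ▸ Set.mem_univ v : v ∈ {w | T.Adj v w})

theorem score_map {S : Tournament V} {T : Tournament W} (e : S.Adj ≃r T.Adj) (v : V) :
    T.score (e v) = S.score v := by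
  refine (Set.BijOn.ncard_eq (f := e) ⟨?_, e.injective.injOn, ?_⟩).symm
  · intro w hw
    exact e.map_rel_iff.2 hw
  · intro w hw
    refine ⟨e.symm w, ?_, e.apply_symm_apply w⟩
    change S.Adj v (e.symm w)
    rw [← e.map_rel_iff, e.apply_symm_apply]
    exact hw

theorem Iso.scoreVector_eq [Fintype V] [Fintype W] {S : Tournament V} {T : Tournament W}
    (h : S.Iso T) : S.scoreVector = T.scoreVector := by
  obtain ⟨e⟩ := h
  rw [scoreVector, scoreVector, ← Finset.map_univ_equiv e.toEquiv, Finset.map_val,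
    Multiset.map_map]
  exact Multiset.map_congr rfl fun v _ => (score_map e v).symm

theorem card_scoreVector [Fintype V] (T : Tournament V) :
    Multiset.card T.scoreVector = Fintype.card V :=
  Multiset.card_map _ _

theorem Iso.card_eq [Fintype V] [Fintype W] {S : Tournament V} {T : Tournament W}
    (h : S.Iso T) : Fintype.card V = Fintype.card W :=
  h.elim fun e => Fintype.card_congr e.toEquiv

theorem exists_equiv_of_scoreVector_eq [Fintype V] [Fintype W] {S : Tournament V}
    {T : Tournament W} (h : S.scoreVector = T.scoreVector) :
    ∃ e : V ≃ W, ∀ v, T.score (e v) = S.score v := by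
  classical
  have key : ∀ c : ℕ, Nonempty ({v // S.score v = c} ≃ {w // T.score w = c}) := by
    intro c
    refine ⟨Fintype.equivOfCardEq ?_⟩
    have := congrArg (Multiset.count c) h
    simp only [scoreVector, Multiset.count_map] at this
    rw [Fintype.card_subtype, Fintype.card_subtype, Finset.card_def, Finset.card_def,
      Finset.filter_val, Finset.filter_val]
    simpa only [eq_comm] using this
  exact ⟨Equiv.ofFiberEquiv fun c => (key c).some, fun v => Equiv.ofFiberEquiv_map _ v⟩

theorem IsUnique.iso_of_scoreVector_eq [Fintype V] [Fintype W] {S : Tournament V}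
    {T : Tournament W} (hT : T.IsUnique) (h : S.scoreVector = T.scoreVector) : S.Iso T := by
  obtain ⟨e, -⟩ := exists_equiv_of_scoreVector_eq h
  exact (S.iso_relabel e).trans (hT _ ((S.iso_relabel e).scoreVector_eq.symm.trans h))

theorem IsUnique.of_iso [Fintype V] [Fintype W] {S : Tournament V} {T : Tournament W}
    (hT : T.IsUnique) (h : S.Iso T) : S.IsUnique := fun _ hR =>
  (hT.iso_of_scoreVector_eq (hR.trans h.scoreVector_eq)).trans h.symm

/-- Uniqueness may be tested on tournaments in which every single vertex has its given score. -/
theorem isUnique_iff [Fintype V] {T : Tournament V} :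
    T.IsUnique ↔ ∀ S : Tournament V, (∀ v, S.score v = T.score v) → S.Iso T := by
  constructor
  · intro h S hS
    exact h S (Multiset.map_congr rfl fun v _ => hS v)
  · intro h S hS
    obtain ⟨e, he⟩ := exists_equiv_of_scoreVector_eq hS
    refine (S.iso_relabel e).trans (h _ fun v => ?_)
    have h1 := score_map (⟨e, by simp [relabel]⟩ : S.Adj ≃r (S.relabel e).Adj) (e.symm v)
    have h2 := he (e.symm v)
    rw [e.apply_symm_apply] at h2
    rw [h2, ← h1]
    simp

open scoped Classical in
/-- Every pair of vertices of `X` contributes exactly one win inside `X`. -/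
theorem two_mul_sum_wins [Fintype V] (T : Tournament V) (X : Finset V) :
    2 * ∑ v ∈ X, (X.filter fun w => T.Adj v w).card = X.card * (X.card - 1) := by
  have h1 : ∑ v ∈ X, (X.filter fun w => T.Adj v w).card
      = ∑ v ∈ X, (X.filter fun w => T.Adj w v).card :=
    Finset.sum_card_bipartiteAbove_eq_sum_card_bipartiteBelow _
  rw [two_mul]
  nth_rw 2 [h1]
  rw [← Finset.sum_add_distrib, ← smul_eq_mul, ← Finset.sum_const]
  refine Finset.sum_congr rfl fun v hv => ?_
  rw [← Finset.card_erase_of_mem hv, ← Finset.card_union_of_disjoint]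
  · congr 1
    ext w
    simp only [Finset.mem_union, Finset.mem_filter, Finset.mem_erase]
    constructor
    · rintro (⟨h, h'⟩ | ⟨h, h'⟩)
      · exact ⟨(ne_of_adj h').symm, h⟩
      · exact ⟨ne_of_adj h', h⟩
    · rintro ⟨h, h'⟩
      exact (T.total v w h.symm).imp (⟨h', ·⟩) (⟨h', ·⟩)
  · refine Finset.disjoint_filter.2 fun w _ h => T.asymm _ _ h

theorem two_mul_sum_score [Fintype V] (T : Tournament V) :
    2 * ∑ v, T.score v = Fintype.card V * (Fintype.card V - 1) := by
  classical
  have h := T.two_mul_sum_wins Finset.univ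
  rw [Finset.card_univ] at h
  rw [← h]
  congr 1
  refine Finset.sum_congr rfl fun v _ => ?_
  rw [score_eq_sum, Finset.sum_boole]
  rfl

end Score

/-! ### Scores and uniqueness of compositions -/

section Sum

theorem eq_sum_of_forall_not_adj {S : Tournament (V ⊕ W)}
    (h : ∀ v w, ¬ S.Adj (Sum.inl v) (Sum.inr w)) :
    S = (S.comap Sum.inl Sum.inl_injective).sum (S.comap Sum.inr Sum.inr_injective) := by
  refine ext_adj ?_
  rintro (v | v) (w | w)
  · exact Iff.rfl
  · exact iff_of_false (h v w) id
  · exact iff_of_true (adj_of_not_adj (by simp) (h w v)) trivial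
  · exact Iff.rfl

variable [Fintype V] [Fintype W]

theorem score_sum_inl (A : Tournament V) (B : Tournament W) (v : V) :
    (A.sum B).score (Sum.inl v) = A.score v := by
  classical
  simp only [score_eq_sum, Fintype.sum_sum_type]
  have h : ∀ w, ¬ (A.sum B).Adj (Sum.inl v) (Sum.inr w) := fun _ => id
  rw [Finset.sum_eq_zero fun w _ => if_neg (h w), add_zero]
  rfl

theorem score_sum_inr (A : Tournament V) (B : Tournament W) (w : W) :
    (A.sum B).score (Sum.inr w) = B.score w + Fintype.card V := by
  classical
  simp only [score_eq_sum, Fintype.sum_sum_type]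
  have h : ∀ v, (A.sum B).Adj (Sum.inr w) (Sum.inl v) := fun _ => trivial
  rw [Finset.sum_congr rfl fun v _ => if_pos (h v), add_comm]
  simp only [Finset.sum_const, Finset.card_univ, smul_eq_mul, mul_one]
  rfl

theorem scoreVector_sum (A : Tournament V) (B : Tournament W) :
    (A.sum B).scoreVector = A.scoreVector + B.scoreVector.map (· + Fintype.card V) := by
  have huniv : (Finset.univ : Finset (V ⊕ W)).val
      = (Finset.univ : Finset V).val.map Sum.inl + (Finset.univ : Finset W).val.map Sum.inr :=
    rfl
  simp only [scoreVector]
  rw [huniv, Multiset.map_add, Multiset.map_map, Multiset.map_map, Multiset.map_map]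
  congr 1
  · exact Multiset.map_congr rfl fun v _ => score_sum_inl A B v
  · exact Multiset.map_congr rfl fun w _ => score_sum_inr A B w

/-- The scores of a composition force the composition: the vertices of the first group have
together only as many wins as they have games among themselves, so they win no other game. -/
theorem eq_sum_of_score_eq {A : Tournament V} {B : Tournament W} {S : Tournament (V ⊕ W)}
    (h : ∀ x, S.score x = (A.sum B).score x) :
    S = (S.comap Sum.inl Sum.inl_injective).sum (S.comap Sum.inr Sum.inr_injective) := by
  classical
  set A' := S.comap Sum.inl Sum.inl_injective with hA'
  have h1 : ∀ v, S.score (Sum.inl v)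
      = A'.score v + ∑ w, if S.Adj (Sum.inl v) (Sum.inr w) then 1 else 0 := by
    intro v
    simp only [score_eq_sum, Fintype.sum_sum_type]
    rfl
  have h2 : ∑ v, A.score v
      = ∑ v, A'.score v + ∑ v, ∑ w, if S.Adj (Sum.inl v) (Sum.inr w) then 1 else 0 := by
    rw [← Finset.sum_add_distrib]
    refine Finset.sum_congr rfl fun v _ => ?_
    rw [← h1, h, score_sum_inl]
  have h3 := A.two_mul_sum_score
  have h4 := A'.two_mul_sum_score
  have h5 : ∑ v, ∑ w, (if S.Adj (Sum.inl v) (Sum.inr w) then 1 else 0) = 0 := by omega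
  refine eq_sum_of_forall_not_adj fun v w hvw => ?_
  have h6 := Finset.sum_eq_zero_iff.1 (Finset.sum_eq_zero_iff.1 h5 v (Finset.mem_univ v)) w
    (Finset.mem_univ w)
  simp [hvw] at h6

theorem IsUnique.sum {A : Tournament V} {B : Tournament W} (hA : A.IsUnique) (hB : B.IsUnique) :
    (A.sum B).IsUnique := by
  rw [isUnique_iff]
  intro S hS
  have hSum := eq_sum_of_score_eq hS
  generalize S.comap Sum.inl Sum.inl_injective = A' at hSum
  generalize S.comap Sum.inr Sum.inr_injective = B' at hSum
  subst hSum
  refine sum_congr (isUnique_iff.1 hA _ fun v => ?_) (isUnique_iff.1 hB _ fun w => ?_)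
  · have := hS (Sum.inl v)
    rwa [score_sum_inl, score_sum_inl] at this
  · have := hS (Sum.inr w)
    rw [score_sum_inr, score_sum_inr] at this
    omega

/-- Exactly the first group has scores below its own size, so an isomorphism between
compositions with equal group sizes respects the groups. -/
theorem isLeft_iff_score_lt (A : Tournament V) (B : Tournament W) (x : V ⊕ W) :
    x.isLeft ↔ (A.sum B).score x < Fintype.card V := by
  rcases x with v | w
  · simpa [score_sum_inl] using A.score_lt_card v
  · simp [score_sum_inr]

theorem iso_of_sum_iso {A A' : Tournament V} {B B' : Tournament W}
    (h : (A'.sum B').Iso (A.sum B)) : A'.Iso A ∧ B'.Iso B := by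
  obtain ⟨e⟩ := h
  have hl : ∀ x, (e x).isLeft ↔ x.isLeft := fun x => by
    rw [isLeft_iff_score_lt A B, score_map e, ← isLeft_iff_score_lt A' B']
  constructor
  · have : ∀ v, ∃ v', e (Sum.inl v) = Sum.inl v' := fun v =>
      Sum.isLeft_iff.1 ((hl _).2 rfl)
    choose f hf using this
    refine iso_of_hom f (fun v w hvw => ?_) le_rfl
    have h : (A.sum B).Adj (e (Sum.inl v)) (e (Sum.inl w)) := e.map_rel_iff.2 hvw
    rwa [hf, hf] at h
  · have : ∀ v, ∃ v', e (Sum.inr v) = Sum.inr v' := fun v => by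
      have := hl (Sum.inr v)
      rw [← Sum.isRight_iff, ← Sum.not_isLeft]
      simpa using this
    choose f hf using this
    refine iso_of_hom f (fun v w hvw => ?_) le_rfl
    have h : (A.sum B).Adj (e (Sum.inr v)) (e (Sum.inr w)) := e.map_rel_iff.2 hvw
    rwa [hf, hf] at h

theorem IsUnique.of_sum {A : Tournament V} {B : Tournament W} (h : (A.sum B).IsUnique) :
    A.IsUnique ∧ B.IsUnique := by
  rw [isUnique_iff] at h
  refine ⟨isUnique_iff.2 fun A' hA' => (iso_of_sum_iso (h (A'.sum B) ?_)).1,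
    isUnique_iff.2 fun B' hB' => (iso_of_sum_iso (h (A.sum B') ?_)).2⟩
  · rintro (v | w)
    · rw [score_sum_inl, score_sum_inl, hA']
    · rw [score_sum_inr, score_sum_inr]
  · rintro (v | w)
    · rw [score_sum_inl, score_sum_inl]
    · rw [score_sum_inr, score_sum_inr, hB']

end Sum

end Tournament

/-! ### Reversal of a 3-cycle -/

namespace Tournament

variable {V W : Type*}

/-- `v` and `w` are consecutive on the cycle through `x`, `y`, `z`, in this order. -/
def OnCycle (x y z v w : V) : Prop := (v = x ∧ w = y) ∨ (v = y ∧ w = z) ∨ (v = z ∧ w = x)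

theorem OnCycle.adj {T : Tournament V} {x y z v w : V} (h : OnCycle x y z v w)
    (hxy : T.Adj x y) (hyz : T.Adj y z) (hzx : T.Adj z x) : T.Adj v w := by
  rcases h with ⟨rfl, rfl⟩ | ⟨rfl, rfl⟩ | ⟨rfl, rfl⟩ <;> assumption

/-- The tournament in which the three results of a 3-cycle are reversed. -/
def reverse (T : Tournament V) {x y z : V} (hxy : T.Adj x y) (hyz : T.Adj y z)
    (hzx : T.Adj z x) : Tournament V where
  Adj v w := (T.Adj v w ∧ ¬ OnCycle x y z v w) ∨ OnCycle x y z w v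
  asymm v w := by
    rintro (⟨h, h'⟩ | h) (⟨k, k'⟩ | k)
    · exact T.asymm _ _ h k
    · exact h' k
    · exact k' h
    · exact T.asymm _ _ (h.adj hxy hyz hzx) (k.adj hxy hyz hzx)
  total v w hne := by
    by_cases h : OnCycle x y z v w
    · exact Or.inr (Or.inr h)
    by_cases h' : OnCycle x y z w v
    · exact Or.inl (Or.inr h')
    exact (T.total v w hne).imp (fun k => Or.inl ⟨k, h⟩) (fun k => Or.inl ⟨k, h'⟩)

variable [Fintype V] [Fintype W]

open scoped Classical in
/-- The total weight of the vertices against which `v` wins. -/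
noncomputable def winSum (T : Tournament V) (g : V → ℤ) (v : V) : ℤ :=
  ∑ w, if T.Adj v w then g w else 0

open scoped Classical in
/-- The number of wins of `v` against vertices with the score of `v`. -/
noncomputable def inner (T : Tournament V) (v : V) : ℕ :=
  (Finset.univ.filter fun w => T.Adj v w ∧ T.score w = T.score v).card

open scoped Classical in
/-- The number of wins of `v` against vertices with a score different from that of `v`. -/
noncomputable def outer (T : Tournament V) (v : V) : ℕ :=
  (Finset.univ.filter fun w => T.Adj v w ∧ T.score w ≠ T.score v).card

theorem score_eq_winSum (T : Tournament V) (v : V) :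
    (T.score v : ℤ) = T.winSum (fun _ => 1) v := by
  rw [score_eq_sum, winSum]
  push_cast
  rfl

open scoped Classical in
theorem inner_eq_winSum (T : Tournament V) (v : V) :
    (T.inner v : ℤ) = T.winSum (fun w => if T.score w = T.score v then 1 else 0) v := by
  rw [inner, winSum, Finset.card_filter]
  push_cast
  exact Finset.sum_congr rfl fun w _ => ite_and ..

theorem inner_add_outer (T : Tournament V) (v : V) : T.inner v + T.outer v = T.score v := by
  classical
  have h := Finset.card_filter_add_card_filter_not (s := Finset.univ.filter fun w => T.Adj v w)
    (fun w => T.score w = T.score v)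
  rw [Finset.filter_filter, Finset.filter_filter] at h
  rw [score_eq_sum, Finset.sum_boole, inner, outer, Nat.cast_id, ← h]

open scoped Classical in
theorem winSum_map {S : Tournament V} {T : Tournament W} (e : S.Adj ≃r T.Adj) (g : W → ℤ)
    (v : V) : T.winSum g (e v) = S.winSum (fun w => g (e w)) v := by
  rw [winSum, winSum, ← Equiv.sum_comp e.toEquiv]
  refine Finset.sum_congr rfl fun w _ => ?_
  change (if T.Adj (e v) (e w) then g (e w) else 0) = _
  exact if_congr e.map_rel_iff rfl rfl

theorem inner_map {S : Tournament V} {T : Tournament W} (e : S.Adj ≃r T.Adj) (v : V) :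
    T.inner (e v) = S.inner v := by
  have h : (T.inner (e v) : ℤ) = S.inner v := by
    rw [inner_eq_winSum, inner_eq_winSum, winSum_map e]
    simp only [score_map]
  exact_mod_cast h

section Reverse

variable {T : Tournament V} {x y z : V} (hxy : T.Adj x y) (hyz : T.Adj y z) (hzx : T.Adj z x)

open scoped Classical in
theorem winSum_reverse (g : V → ℤ) (v : V) :
    (T.reverse hxy hyz hzx).winSum g v = T.winSum g v + (if v = x then g z - g y else 0)
      + (if v = y then g x - g z else 0) + (if v = z then g y - g x else 0) := by
  have e : ∀ w, (if (T.reverse hxy hyz hzx).Adj v w then g w else 0)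
      = (if T.Adj v w then g w else 0)
        + (if v = x then (if w = z then g w else 0) - (if w = y then g w else 0) else 0)
        + (if v = y then (if w = x then g w else 0) - (if w = z then g w else 0) else 0)
        + (if v = z then (if w = y then g w else 0) - (if w = x then g w else 0) else 0) := by
    intro w
    have h1 := T.asymm _ _ hxy
    have h2 := T.asymm _ _ hyz
    have h3 := T.asymm _ _ hzx
    have h4 := ne_of_adj hxy
    have h5 := ne_of_adj hyz
    have h6 := ne_of_adj hzx
    simp only [reverse, OnCycle]
    grind
  have key : ∀ (p : Prop) (a b : V), ∑ w, (if p then (if w = a then g w else 0)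
      - (if w = b then g w else 0) else 0) = if p then g a - g b else 0 := by
    intro p a b
    split_ifs <;> simp
  simp only [winSum, e, Finset.sum_add_distrib, key]

theorem score_reverse (v : V) : (T.reverse hxy hyz hzx).score v = T.score v := by
  classical
  have h := winSum_reverse hxy hyz hzx (fun _ => 1) v
  simp only [sub_self, ite_self, add_zero, ← score_eq_winSum] at h
  exact_mod_cast h

theorem reverse_iso (hT : T.IsUnique) : (T.reverse hxy hyz hzx).Iso T :=
  isUnique_iff.1 hT _ (score_reverse hxy hyz hzx)

theorem IsUnique.reverse (hT : T.IsUnique) : (T.reverse hxy hyz hzx).IsUnique :=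
  hT.of_iso (reverse_iso hxy hyz hzx hT)

open scoped Classical in
theorem inner_reverse (v : V) :
    ((T.reverse hxy hyz hzx).inner v : ℤ) = T.inner v
      + (if v = x then (if T.score z = T.score v then 1 else 0)
          - (if T.score y = T.score v then 1 else 0) else 0)
      + (if v = y then (if T.score x = T.score v then 1 else 0)
          - (if T.score z = T.score v then 1 else 0) else 0)
      + (if v = z then (if T.score y = T.score v then 1 else 0)
          - (if T.score x = T.score v then 1 else 0) else 0) := by
  rw [inner_eq_winSum, inner_eq_winSum, winSum_reverse]
  simp only [score_reverse]

end Reverse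

/-! ### Uniqueness controls the 3-cycles -/

section Unique

variable {T : Tournament V}

/-- A 3-cycle with three different scores cannot be reversed without changing the isomorphism
type: the sum of `score v * score w ^ 2` over all results `v → w` changes by the Vandermonde
product of the three scores. -/
theorem IsUnique.not_rainbow (hT : T.IsUnique) {x y z : V} (hxy : T.Adj x y) (hyz : T.Adj y z)
    (hzx : T.Adj z x) (h1 : T.score x ≠ T.score y) (h2 : T.score y ≠ T.score z)
    (h3 : T.score z ≠ T.score x) : False := by
  classical
  obtain ⟨e⟩ := reverse_iso hxy hyz hzx hT
  have h : ∑ v, (T.score v : ℤ) * T.winSum (fun w => (T.score w : ℤ) ^ 2) v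
      = ∑ v, (T.score v : ℤ)
        * (T.reverse hxy hyz hzx).winSum (fun w => (T.score w : ℤ) ^ 2) v := by
    rw [← Equiv.sum_comp e.toEquiv]
    refine Finset.sum_congr rfl fun v _ => ?_
    change (T.score (e v) : ℤ) * T.winSum _ (e v) = _
    rw [winSum_map e, score_map e, score_reverse]
    simp only [score_map, score_reverse]
  simp only [winSum_reverse, mul_add, Finset.sum_add_distrib, mul_ite, mul_zero,
    Finset.sum_ite_eq', Finset.mem_univ, if_true] at h
  have h' : ((T.score x : ℤ) - T.score y) * ((T.score y : ℤ) - T.score z)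
      * ((T.score z : ℤ) - T.score x) = 0 := by
    linear_combination h
  simp only [mul_eq_zero, sub_eq_zero, Nat.cast_inj] at h'
  tauto

/-- Reversing a 3-cycle with scores `s, s, t` moves one inner win between its two vertices of
score `s`. As the sum of the squares of all `inner` values cannot change, the two values are
exchanged. -/
theorem IsUnique.inner_eq_add_one (hT : T.IsUnique) {x y z : V} (hxy : T.Adj x y)
    (hyz : T.Adj y z) (hzx : T.Adj z x) (h1 : T.score x = T.score y)
    (h2 : T.score z ≠ T.score x) : T.inner x = T.inner y + 1 := by
  classical
  obtain ⟨e⟩ := reverse_iso hxy hyz hzx hT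
  have h : ∑ v, (T.inner v : ℤ) ^ 2 = ∑ v, ((T.reverse hxy hyz hzx).inner v : ℤ) ^ 2 := by
    rw [← Equiv.sum_comp e.toEquiv]
    refine Finset.sum_congr rfl fun v _ => ?_
    change (T.inner (e v) : ℤ) ^ 2 = _
    rw [inner_map e]
  have hr : ∀ v, ((T.reverse hxy hyz hzx).inner v : ℤ) ^ 2 = (T.inner v : ℤ) ^ 2
      + (if v = x then 1 - 2 * (T.inner x : ℤ) else 0)
      + (if v = y then 1 + 2 * (T.inner y : ℤ) else 0) := by
    intro v
    have h4 := ne_of_adj hxy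
    have h5 := ne_of_adj hyz
    have h6 := ne_of_adj hzx
    rw [inner_reverse]
    by_cases hx : v = x
    · subst hx
      simp [h4, h6.symm, h2, h1.symm]
      ring
    by_cases hy : v = y
    · subst hy
      simp [h4.symm, h5, h1, h1 ▸ h2]
      ring
    by_cases hz : v = z
    · subst hz
      simp [h5.symm, h6, h2.symm, h1 ▸ h2.symm]
    simp [hx, hy, hz]
  simp only [hr, Finset.sum_add_distrib, Finset.sum_ite_eq', Finset.mem_univ, if_true] at h
  omega

open scoped Classical in
theorem exists_adj_not_adj_of_lt {P : V → Prop} [DecidablePred P] {a b : V}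
    (h : (Finset.univ.filter fun w => T.Adj a w ∧ P w).card
      < (Finset.univ.filter fun w => T.Adj b w ∧ P w).card) :
    ∃ w, P w ∧ T.Adj b w ∧ ¬ T.Adj a w := by
  obtain ⟨w, hw, hw'⟩ := Finset.exists_mem_notMem_of_card_lt_card h
  simp only [Finset.mem_filter, Finset.mem_univ, true_and] at hw hw'
  exact ⟨w, hw.2, hw.1, fun k => hw' ⟨k, hw.2⟩⟩

open scoped Classical in
theorem exists_adj_not_adj_of_le {P : V → Prop} [DecidablePred P] {a b w : V}
    (h : (Finset.univ.filter fun w => T.Adj a w ∧ P w).card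
      ≤ (Finset.univ.filter fun w => T.Adj b w ∧ P w).card)
    (hw : P w) (ha : T.Adj a w) (hb : ¬ T.Adj b w) :
    ∃ w', P w' ∧ T.Adj b w' ∧ ¬ T.Adj a w' := by
  by_contra hc
  push Not at hc
  refine absurd h (not_le.2 (Finset.card_lt_card ⟨fun v hv => ?_, fun hs => ?_⟩))
  · simp only [Finset.mem_filter, Finset.mem_univ, true_and] at hv ⊢
    exact ⟨hc v hv.2 hv.1, hv.2⟩
  · have := hs (Finset.mem_filter.2 ⟨Finset.mem_univ w, ha, hw⟩)
    exact hb (Finset.mem_filter.1 this).2.1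

theorem exists_adj_not_adj_of_outer_lt {a b : V} (hs : T.score a = T.score b)
    (h : T.outer a < T.outer b) :
    ∃ w, T.score w ≠ T.score a ∧ T.Adj b w ∧ ¬ T.Adj a w := by
  classical
  rw [outer, outer, ← hs] at h
  exact exists_adj_not_adj_of_lt h

theorem exists_adj_not_adj_of_inner_lt {a b : V} (hs : T.score a = T.score b)
    (h : T.inner a < T.inner b) :
    ∃ w, T.score w = T.score a ∧ T.Adj b w ∧ ¬ T.Adj a w := by
  classical
  rw [inner, inner, ← hs] at h
  exact exists_adj_not_adj_of_lt h

theorem IsUnique.inner_le_of_adj (hT : T.IsUnique) {a b : V} (hs : T.score a = T.score b)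
    (hab : T.Adj a b) : T.inner a ≤ T.inner b + 1 := by
  by_contra hlt
  have h1 := T.inner_add_outer a
  have h2 := T.inner_add_outer b
  obtain ⟨w, hw, hbw, haw⟩ := exists_adj_not_adj_of_outer_lt hs (by omega)
  have hwa := adj_of_not_adj (fun h => hw (h ▸ rfl) : a ≠ w) haw
  have := hT.inner_eq_add_one hab hbw hwa hs hw
  omega

/-- Vertices with equal scores have almost equal numbers of inner wins. -/
theorem IsUnique.inner_le (hT : T.IsUnique) {a b : V} (hs : T.score a = T.score b) :
    T.inner a ≤ T.inner b + 1 := by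
  classical
  by_contra hlt
  have hne : a ≠ b := by
    rintro rfl
    omega
  rcases T.total a b hne with hab | hba
  · exact hlt (hT.inner_le_of_adj hs hab)
  -- Reversing a 3-cycle inside the score class turns the result between `a` and `b` around and
  -- keeps all inner scores.
  obtain ⟨w, hw, haw, hbw⟩ := exists_adj_not_adj_of_inner_lt hs.symm (by omega)
  have hwb := adj_of_not_adj (by rintro rfl; exact T.asymm _ _ hba haw) hbw
  have hin : ∀ v, (T.reverse haw hwb hba).inner v = T.inner v := by
    intro v
    have h := inner_reverse haw hwb hba v
    simp only [hw, hs, sub_self, ite_self, add_zero] at h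
    exact_mod_cast h
  have := (hT.reverse haw hwb hba).inner_le_of_adj (a := a) (b := b)
    (by rw [score_reverse, score_reverse, hs]) (Or.inr (Or.inr (Or.inr ⟨rfl, rfl⟩)))
  rw [hin, hin] at this
  exact hlt this

theorem IsUnique.adj_of_adj (hT : T.IsUnique) {a b c : V} (hs : T.score a = T.score b)
    (hi : T.inner a = T.inner b) (hc : T.score c ≠ T.score a) (hac : T.Adj a c) :
    T.Adj b c := by
  classical
  by_contra hbc
  have hne : a ≠ b := by
    rintro rfl
    exact hbc hac
  have hcb := adj_of_not_adj (by rintro rfl; exact hc hs.symm) hbc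
  have h1 := T.inner_add_outer a
  have h2 := T.inner_add_outer b
  obtain ⟨d, hd, hbd, had⟩ : ∃ d, T.score d ≠ T.score a ∧ T.Adj b d ∧ ¬ T.Adj a d := by
    have ho : T.outer a ≤ T.outer b := by omega
    rw [outer, outer, ← hs] at ho
    exact exists_adj_not_adj_of_le ho hc hac hbc
  have hda := adj_of_not_adj (by rintro rfl; exact hd rfl) had
  rcases T.total a b hne with h | h
  · have := hT.inner_eq_add_one h hbd hda hs hd
    omega
  · have := hT.inner_eq_add_one h hac hcb hs.symm (hs ▸ hc)
    omega

/-- Vertices with the same score and the same number of inner wins cannot be distinguished by a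
vertex with another score. -/
theorem IsUnique.adj_iff (hT : T.IsUnique) {a b c : V} (hs : T.score a = T.score b)
    (hi : T.inner a = T.inner b) (hc : T.score c ≠ T.score a) :
    T.Adj a c ↔ T.Adj b c :=
  ⟨hT.adj_of_adj hs hi hc, hT.adj_of_adj hs.symm hi.symm (hs ▸ hc)⟩

/-- A vertex with a third score is on the same side of all three vertices of a 3-cycle with two
different scores; otherwise the cycle, or the reversed cycle, gives a 3-cycle with three
different scores. -/
theorem IsUnique.adj_cycle_iff (hT : T.IsUnique) {x y z c : V} (hxy : T.Adj x y)
    (hyz : T.Adj y z) (hzx : T.Adj z x) (h1 : T.score x = T.score y)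
    (h2 : T.score z ≠ T.score x) (hcx : T.score c ≠ T.score x) (hcz : T.score c ≠ T.score z) :
    (T.Adj c x ↔ T.Adj c y) ∧ (T.Adj c x ↔ T.Adj c z) := by
  have hT' := hT.reverse hxy hyz hzx
  have nx : c ≠ x := by rintro rfl; exact hcx rfl
  have ny : c ≠ y := by rintro rfl; exact hcx h1.symm
  have nz : c ≠ z := by rintro rfl; exact hcz rfl
  have hcy := h1 ▸ hcx
  have h2' := h1 ▸ h2
  have keep : ∀ v w, T.Adj v w → ¬ OnCycle x y z v w → (T.reverse hxy hyz hzx).Adj v w :=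
    fun v w h h' => Or.inl ⟨h, h'⟩
  have hc1 : ∀ v, ¬ OnCycle x y z c v := by
    rintro v (h | h | h)
    exacts [nx h.1, ny h.1, nz h.1]
  have hc2 : ∀ v, ¬ OnCycle x y z v c := by
    rintro v (h | h | h)
    exacts [ny h.2, nz h.2, nx h.2]
  -- the two rainbow cycles through `z` and `c` in the tournament and in its reversal
  have r1 : T.Adj x c → T.Adj c z → False := fun h h' =>
    hT.not_rainbow h h' hzx hcx.symm hcz h2
  have r2 : T.Adj z c → T.Adj c y → False := fun h h' =>
    hT.not_rainbow h h' hyz hcz.symm hcy h2'.symm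
  have r3 : T.Adj y c → T.Adj c z → False := fun h h' =>
    hT'.not_rainbow (keep _ _ h (hc2 _)) (keep _ _ h' (hc1 _))
      (Or.inr (Or.inr (Or.inl ⟨rfl, rfl⟩)) : (T.reverse hxy hyz hzx).Adj z y)
      (by simpa only [score_reverse] using hcy.symm)
      (by simpa only [score_reverse] using hcz) (by simpa only [score_reverse] using h2')
  have r4 : T.Adj z c → T.Adj c x → False := fun h h' =>
    hT'.not_rainbow (keep _ _ h (hc2 _)) (keep _ _ h' (hc1 _))
      (Or.inr (Or.inr (Or.inr ⟨rfl, rfl⟩)) : (T.reverse hxy hyz hzx).Adj x z)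
      (by simpa only [score_reverse] using hcz.symm)
      (by simpa only [score_reverse] using hcx) (by simpa only [score_reverse] using h2.symm)
  have ax : T.Adj c x ↔ ¬ T.Adj x c := ⟨T.asymm _ _, adj_of_not_adj nx.symm⟩
  have ay : T.Adj c y ↔ ¬ T.Adj y c := ⟨T.asymm _ _, adj_of_not_adj ny.symm⟩
  have az : T.Adj c z ↔ ¬ T.Adj z c := ⟨T.asymm _ _, adj_of_not_adj nz.symm⟩
  tauto

end Unique

end Tournament

/-! ### Score classes of a unique tournament -/

namespace Tournament

variable {V : Type*} {T : Tournament V}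

theorem adj_comm_iff {a b c : V} (ha : c ≠ a) (hb : c ≠ b) :
    (T.Adj a c ↔ T.Adj b c) ↔ (T.Adj c a ↔ T.Adj c b) := by
  have h1 : T.Adj c a ↔ ¬ T.Adj a c := ⟨T.asymm _ _, adj_of_not_adj ha.symm⟩
  have h2 : T.Adj c b ↔ ¬ T.Adj b c := ⟨T.asymm _ _, adj_of_not_adj hb.symm⟩
  rw [h1, h2, not_iff_not]

theorem ne_of_score_ne {a b : V} (h : T.score a ≠ T.score b) : a ≠ b := by
  rintro rfl
  exact h rfl

variable [Fintype V]

theorem IsUnique.adj_iff' (hT : T.IsUnique) {a b c : V} (hs : T.score a = T.score b)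
    (hi : T.inner a = T.inner b) (hc : T.score c ≠ T.score a) :
    T.Adj c a ↔ T.Adj c b :=
  (adj_comm_iff (ne_of_score_ne hc) (ne_of_score_ne (hs ▸ hc))).1 (hT.adj_iff hs hi hc)

open scoped Classical in
/-- If the inner scores of a score class take the values `k` and `k + 1`, both of them, then each
is taken equally often, namely `k + 1` times, because the inner scores of a class of size `N` add
up to `N * (N - 1) / 2`. -/
theorem card_inner_eq {s k : ℕ} (h : ∀ v, T.score v = s → T.inner v = k ∨ T.inner v = k + 1)
    {a b : V} (ha : T.score a = s) (hka : T.inner a = k) (hb : T.score b = s)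
    (hkb : T.inner b = k + 1) :
    (Finset.univ.filter fun v => T.score v = s ∧ T.inner v = k).card = k + 1 ∧
      (Finset.univ.filter fun v => T.score v = s ∧ T.inner v = k + 1).card = k + 1 := by
  set X := Finset.univ.filter fun v => T.score v = s with hX
  have e1 : (Finset.univ.filter fun v => T.score v = s ∧ T.inner v = k)
      = X.filter fun v => T.inner v = k := by rw [hX, Finset.filter_filter]
  have e2 : (Finset.univ.filter fun v => T.score v = s ∧ T.inner v = k + 1)
      = X.filter fun v => ¬ T.inner v = k := by
    rw [hX, Finset.filter_filter]
    refine Finset.filter_congr fun v _ => and_congr_right fun hv => ?_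
    have := h v hv
    omega
  have hN := Finset.card_filter_add_card_filter_not (s := X) (fun v => T.inner v = k)
  have hlo : 0 < (X.filter fun v => T.inner v = k).card :=
    Finset.card_pos.2 ⟨a, by simp [hX, ha, hka]⟩
  have hhi : 0 < (X.filter fun v => ¬ T.inner v = k).card :=
    Finset.card_pos.2 ⟨b, by simp [hX, hb, hkb]⟩
  have hsum := T.two_mul_sum_wins X
  have hin : ∀ v ∈ X, (X.filter fun w => T.Adj v w).card
      = k + if ¬ T.inner v = k then 1 else 0 := by
    intro v hv
    have hv' : T.score v = s := by simpa [hX] using hv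
    have : (X.filter fun w => T.Adj v w).card = T.inner v := by
      rw [inner, hX, Finset.filter_filter, hv']
      congr 1
      ext w
      simp [and_comm]
    have := h v hv'
    split_ifs <;> omega
  rw [Finset.sum_congr rfl hin, Finset.sum_add_distrib, Finset.sum_const, smul_eq_mul,
    ← Finset.card_filter] at hsum
  rw [e1, e2]
  generalize (X.filter fun v => T.inner v = k).card = lo at *
  generalize (X.filter fun v => ¬ T.inner v = k).card = hi at *
  rw [← hN] at hsum
  have hsum' : ((lo : ℤ) + hi) * (lo + hi - 1 - 2 * k) = 2 * hi := by
    have h1 : 1 ≤ lo + hi := by omega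
    zify [h1] at hsum
    linear_combination -hsum
  have hd : (lo : ℤ) + hi - 1 - 2 * k = 1 := by
    have hp : (0 : ℤ) < lo + hi := by omega
    have h1 : (0 : ℤ) < lo + hi - 1 - 2 * k := by
      by_contra hc
      nlinarith
    have h2 : (lo : ℤ) + hi - 1 - 2 * k < 2 := by
      by_contra hc
      nlinarith
    omega
  rw [hd] at hsum'
  omega

open scoped Classical in
theorem score_eq_add_add (T : Tournament V) {s t : ℕ} (hst : s ≠ t) (v : V) :
    T.score v = (Finset.univ.filter fun w => T.Adj v w ∧ T.score w = s).card
      + (Finset.univ.filter fun w => T.Adj v w ∧ T.score w = t).card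
      + (Finset.univ.filter fun w => T.Adj v w ∧ (T.score w ≠ s ∧ T.score w ≠ t)).card := by
  rw [score_eq_sum, Finset.card_filter, Finset.card_filter, Finset.card_filter,
    ← Finset.sum_add_distrib, ← Finset.sum_add_distrib]
  refine Finset.sum_congr rfl fun w _ => ?_
  by_cases h : T.Adj v w <;> by_cases h1 : T.score w = s <;> by_cases h2 : T.score w = t <;>
    simp_all

/-- A score class with two inner scores contains an arc from a vertex with the higher to a vertex
with the lower one, and this arc lies on a 3-cycle that leaves the class. -/
theorem IsUnique.exists_cycle (hT : T.IsUnique) {a b : V} (hs : T.score a = T.score b)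
    (hi : T.inner a ≠ T.inner b) :
    ∃ x y z, T.score x = T.score a ∧ T.score y = T.score a ∧ T.score z ≠ T.score a ∧
      T.Adj x y ∧ T.Adj y z ∧ T.Adj z x := by
  wlog hlt : T.inner b < T.inner a generalizing a b
  · simpa only [hs] using this hs.symm hi.symm (by omega)
  have hab := hT.inner_le hs
  obtain ⟨x, y, hx, hy, hxy, hlt'⟩ : ∃ x y, T.score x = T.score a ∧ T.score y = T.score a ∧
      T.Adj x y ∧ T.inner y < T.inner x := by
    rcases T.total a b (by rintro rfl; exact hi rfl) with h | h
    · exact ⟨a, b, rfl, hs.symm, h, hlt⟩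
    obtain ⟨w, hw, haw, hbw⟩ := exists_adj_not_adj_of_inner_lt hs.symm hlt
    have hwb := adj_of_not_adj (by rintro rfl; exact T.asymm _ _ h haw) hbw
    have h1 := hT.inner_le (a := a) (b := w) (by rw [hw, hs])
    have h2 := hT.inner_le (a := w) (b := b) hw
    rcases lt_or_ge (T.inner w) (T.inner a) with h3 | h3
    · exact ⟨a, w, rfl, hw.trans hs.symm, haw, h3⟩
    · exact ⟨w, b, hw.trans hs.symm, hs.symm, hwb, by omega⟩
  have h1 := T.inner_add_outer x
  have h2 := T.inner_add_outer y
  obtain ⟨z, hz, hyz, hxz⟩ := exists_adj_not_adj_of_outer_lt (a := x) (b := y)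
    (hx.trans hy.symm) (by omega)
  exact ⟨x, y, z, hx, hy, hx ▸ hz, hxy, hyz, adj_of_not_adj (ne_of_score_ne hz.symm) hxz⟩

section Cycle

variable (hT : T.IsUnique) {x y z : V} (hxy : T.Adj x y) (hyz : T.Adj y z) (hzx : T.Adj z x)
  (h1 : T.score x = T.score y) (h2 : T.score z ≠ T.score x)

include hT hxy hyz hzx h1 h2

theorem inner_eq_or_eq {v : V} (hv : T.score v = T.score x) :
    T.inner v = T.inner y ∨ T.inner v = T.inner y + 1 := by
  have h3 := hT.inner_eq_add_one hxy hyz hzx h1 h2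
  have h4 := hT.inner_le (a := v) (b := y) (hv.trans h1)
  have h5 := hT.inner_le (a := x) (b := v) hv.symm
  omega

/-- A vertex of a third class does not distinguish the members of the class of `x`, because each of
them has the inner score of `x` or of `y`. -/
theorem adj_class_iff {c v : V} (hcx : T.score c ≠ T.score x) (hcz : T.score c ≠ T.score z)
    (hv : T.score v = T.score x) : T.Adj c v ↔ T.Adj c x := by
  have h3 := hT.inner_eq_add_one hxy hyz hzx h1 h2
  rcases inner_eq_or_eq hT hxy hyz hzx h1 h2 hv with h | h
  · rw [hT.adj_iff' (hv.trans h1) h (hv ▸ hcx)]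
    exact (hT.adj_cycle_iff hxy hyz hzx h1 h2 hcx hcz).1.symm
  · exact hT.adj_iff' hv (h.trans h3.symm) (hv ▸ hcx)

open scoped Classical in
/-- The vertex `y` wins one game more than `x` outside of their score class. Only the class of
`z` can account for this. -/
theorem card_adj_class_eq :
    (Finset.univ.filter fun w => T.Adj y w ∧ T.score w = T.score z).card
      = (Finset.univ.filter fun w => T.Adj x w ∧ T.score w = T.score z).card + 1 := by
  classical
  have h3 := hT.inner_eq_add_one hxy hyz hzx h1 h2
  have h4 := T.score_eq_add_add h2.symm x
  have h5 := T.score_eq_add_add h2.symm y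
  have h6 : (Finset.univ.filter fun w => T.Adj x w ∧ (T.score w ≠ T.score x ∧
      T.score w ≠ T.score z)) = (Finset.univ.filter fun w => T.Adj y w ∧
      (T.score w ≠ T.score x ∧ T.score w ≠ T.score z)) := by
    refine Finset.filter_congr fun c _ => and_congr_left fun hc => ?_
    exact (adj_comm_iff (ne_of_score_ne hc.1) (ne_of_score_ne (h1 ▸ hc.1))).2
      (hT.adj_cycle_iff hxy hyz hzx h1 h2 hc.1 hc.2).1
  rw [h6] at h4
  have h7 : (Finset.univ.filter fun w => T.Adj x w ∧ T.score w = T.score x).card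
      = T.inner x := by
    rw [inner]
  have h8 : (Finset.univ.filter fun w => T.Adj y w ∧ T.score w = T.score x).card
      = T.inner y := by
    rw [inner, h1]
  omega

/-- Inside the class of `z`, no vertex distinguishes `x` and `y` in the direction opposite to
`z`: otherwise the class would consist of two halves of equal size, one in each direction. -/
theorem not_adj_of_adj {r : V} (hr : T.score r = T.score z) (hxr : T.Adj x r) :
    ¬ T.Adj r y := by
  classical
  intro hry
  have h2' : T.score z ≠ T.score y := h1 ▸ h2
  have hrz : T.inner r ≠ T.inner z := fun h =>
    T.asymm _ _ hxr ((hT.adj_iff hr.symm h.symm h2.symm).1 hzx)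
  have hle := hT.inner_le hr
  have hle' := hT.inner_le hr.symm
  have hin : ∀ v, T.score v = T.score z → T.inner v = T.inner r ∨ T.inner v = T.inner z := by
    intro v hv
    have a1 := hT.inner_le hv
    have a2 := hT.inner_le (hv.trans hr.symm)
    have a3 := hT.inner_le hv.symm
    have a4 := hT.inner_le (hr.trans hv.symm)
    omega
  have hX : (Finset.univ.filter fun w => T.Adj x w ∧ T.score w = T.score z)
      = Finset.univ.filter fun w => T.score w = T.score z ∧ T.inner w = T.inner r := by
    ext w
    simp only [Finset.mem_filter, Finset.mem_univ, true_and]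
    constructor
    · rintro ⟨h, hw⟩
      refine ⟨hw, (hin w hw).resolve_right fun hwz => ?_⟩
      exact T.asymm _ _ h ((hT.adj_iff hw hwz (hw ▸ h2.symm)).2 hzx)
    · rintro ⟨hw, hwr⟩
      exact ⟨(hT.adj_iff' (hw.trans hr.symm) hwr (hw ▸ h2.symm)).2 hxr, hw⟩
  have hY : (Finset.univ.filter fun w => T.Adj y w ∧ T.score w = T.score z)
      = Finset.univ.filter fun w => T.score w = T.score z ∧ T.inner w = T.inner z := by
    ext w
    simp only [Finset.mem_filter, Finset.mem_univ, true_and]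
    constructor
    · rintro ⟨h, hw⟩
      refine ⟨hw, (hin w hw).resolve_left fun hwr => ?_⟩
      exact T.asymm _ _ h ((hT.adj_iff (hw.trans hr.symm) hwr (hw ▸ h2'.symm)).2 hry)
    · rintro ⟨hw, hwz⟩
      exact ⟨(hT.adj_iff' hw hwz (hw ▸ h2'.symm)).2 hyz, hw⟩
  have hcard := card_adj_class_eq hT hxy hyz hzx h1 h2
  rw [hX, hY] at hcard
  rcases lt_or_gt_of_ne hrz with hlt | hlt
  · have he : T.inner z = T.inner r + 1 := by omega
    have := card_inner_eq (T := T) (s := T.score z) (k := T.inner r)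
      (fun v hv => he ▸ hin v hv) hr rfl rfl he
    rw [he] at hcard
    omega
  · have he : T.inner r = T.inner z + 1 := by omega
    have := card_inner_eq (T := T) (s := T.score z) (k := T.inner z)
      (fun v hv => he ▸ (hin v hv).symm) rfl rfl hr he
    rw [he] at hcard
    omega

/-- Inside its class, `z` is the only vertex that distinguishes `x` and `y`. -/
theorem eq_of_adj_of_adj {r : V} (hr : T.score r = T.score z) (hyr : T.Adj y r)
    (hrx : T.Adj r x) : r = z := by
  classical
  have hcard := card_adj_class_eq hT hxy hyz hzx h1 h2
  set X := Finset.univ.filter fun w => T.Adj x w ∧ T.score w = T.score z with hX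
  set Y := Finset.univ.filter fun w => T.Adj y w ∧ T.score w = T.score z with hY
  have hXY : X ⊆ Y := by
    intro w hw
    simp only [hX, hY, Finset.mem_filter, Finset.mem_univ, true_and] at hw ⊢
    refine ⟨adj_of_not_adj (ne_of_score_ne (hw.2 ▸ h1 ▸ h2)) ?_, hw.2⟩
    exact not_adj_of_adj hT hxy hyz hzx h1 h2 hw.2 hw.1
  have hone : (Y \ X).card = 1 := by
    rw [Finset.card_sdiff_of_subset hXY]
    omega
  obtain ⟨u, hu⟩ := Finset.card_eq_one.1 hone
  have hmem : ∀ w, T.score w = T.score z → T.Adj y w → T.Adj w x → w = u := by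
    intro w hw hyw hwx
    rw [← Finset.mem_singleton, ← hu]
    simp only [hX, hY, Finset.mem_sdiff, Finset.mem_filter, Finset.mem_univ, true_and]
    exact ⟨⟨hyw, hw⟩, fun h => T.asymm _ _ hwx h.1⟩
  rw [hmem r hr hyr hrx, ← hmem z rfl hyz hzx]

theorem eq_of_inner_eq {r : V} (hr : T.score r = T.score z) (hi : T.inner r = T.inner z) :
    r = z :=
  eq_of_adj_of_adj hT hxy hyz hzx h1 h2 hr
    ((hT.adj_iff' hr hi (hr ▸ h1 ▸ h2.symm)).2 hyz) ((hT.adj_iff hr hi (hr ▸ h2.symm)).2 hzx)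

/-- The vertex `z` is not alone in its class: otherwise its score would be that of `y`. -/
theorem exists_ne_score_eq : ∃ r, T.score r = T.score z ∧ T.inner r ≠ T.inner z := by
  classical
  by_contra hc
  push Not at hc
  have hz : ∀ r, T.score r = T.score z → r = z := fun r hr =>
    eq_of_inner_eq hT hxy hyz hzx h1 h2 hr (hc r hr)
  have h2' : T.score z ≠ T.score y := h1 ▸ h2
  have h3 := hT.inner_eq_add_one hxy hyz hzx h1 h2
  have sz := T.score_eq_add_add h2.symm z
  have sy := T.score_eq_add_add h2.symm y
  have e1 : (Finset.univ.filter fun w => T.Adj z w ∧ T.score w = T.score x)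
      = Finset.univ.filter fun w => T.score w = T.score x ∧ T.inner w = T.inner y + 1 := by
    ext w
    simp only [Finset.mem_filter, Finset.mem_univ, true_and]
    constructor
    · rintro ⟨h, hw⟩
      refine ⟨hw, (inner_eq_or_eq hT hxy hyz hzx h1 h2 hw).resolve_left fun hwy => ?_⟩
      exact T.asymm _ _ h ((hT.adj_iff (hw.trans h1) hwy (hw ▸ h2)).2 hyz)
    · rintro ⟨hw, hwx⟩
      exact ⟨(hT.adj_iff' hw (hwx.trans h3.symm) (hw ▸ h2)).2 hzx, hw⟩
  have e2 : (Finset.univ.filter fun w => T.Adj z w ∧ T.score w = T.score z) = ∅ := by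
    refine Finset.filter_eq_empty_iff.2 fun w _ h => ?_
    exact ne_of_adj h.1 (hz w h.2).symm
  have e3 : (Finset.univ.filter fun w => T.Adj y w ∧ T.score w = T.score z) = {z} := by
    ext w
    simp only [Finset.mem_filter, Finset.mem_univ, true_and, Finset.mem_singleton]
    constructor
    · exact fun h => hz w h.2
    · rintro rfl
      exact ⟨hyz, rfl⟩
  have e4 : (Finset.univ.filter fun w => T.Adj y w ∧ T.score w = T.score x).card
      = T.inner y := by
    rw [inner, h1]
  have e5 : (Finset.univ.filter fun w => T.Adj z w ∧ (T.score w ≠ T.score x ∧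
      T.score w ≠ T.score z)) = (Finset.univ.filter fun w => T.Adj y w ∧
      (T.score w ≠ T.score x ∧ T.score w ≠ T.score z)) := by
    refine Finset.filter_congr fun c _ => and_congr_left fun hc => ?_
    have := hT.adj_cycle_iff hxy hyz hzx h1 h2 hc.1 hc.2
    exact (adj_comm_iff (ne_of_score_ne hc.2) (ne_of_score_ne (h1 ▸ hc.1))).2
      (this.2.symm.trans this.1)
  have e6 := (card_inner_eq (T := T) (s := T.score x) (k := T.inner y)
    (fun v hv => inner_eq_or_eq hT hxy hyz hzx h1 h2 hv) h1.symm rfl rfl h3).2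
  rw [e1, e2, e5, e6, Finset.card_empty] at sz
  rw [e3, e4, Finset.card_singleton] at sy
  omega

end Cycle

end Tournament

/-! ### Strong unique tournaments have at most two scores -/

namespace Tournament

variable {V : Type*} [Fintype V] {T : Tournament V}

open scoped Classical in
/-- If some vertex `u` of the class of `x` is determined by its inner score, then each of the two
equally large halves of this class consists of one vertex. -/
theorem card_class_eq_two (hT : T.IsUnique) {x y z : V} (hxy : T.Adj x y) (hyz : T.Adj y z)
    (hzx : T.Adj z x) (h1 : T.score x = T.score y) (h2 : T.score z ≠ T.score x)
    {u : V} (hu : T.score u = T.score x)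
    (huniq : ∀ r, T.score r = T.score u → T.inner r = T.inner u → r = u) :
    (Finset.univ.filter fun v => T.score v = T.score x).card = 2 := by
  have h3 := hT.inner_eq_add_one hxy hyz hzx h1 h2
  have hin := fun v hv => inner_eq_or_eq hT hxy hyz hzx h1 h2 (v := v) hv
  have hc := card_inner_eq (T := T) (s := T.score x) (k := T.inner y) hin h1.symm rfl rfl h3
  have hone : (Finset.univ.filter fun v => T.score v = T.score x ∧ T.inner v = T.inner u).card
      = 1 := by
    refine Finset.card_eq_one.2 ⟨u, ?_⟩
    ext w
    simp only [Finset.mem_filter, Finset.mem_univ, true_and, Finset.mem_singleton]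
    constructor
    · exact fun h => huniq w (h.1.trans hu.symm) h.2
    · rintro rfl
      exact ⟨hu, rfl⟩
  have hk : T.inner y = 0 := by
    rcases hin u hu with h | h <;> rw [h] at hone <;> omega
  have hN := Finset.card_filter_add_card_filter_not
    (s := Finset.univ.filter fun v => T.score v = T.score x) (fun v => T.inner v = T.inner y)
  rw [Finset.filter_filter, Finset.filter_filter] at hN
  have e : (Finset.univ.filter fun v => T.score v = T.score x ∧ ¬ T.inner v = T.inner y)
      = Finset.univ.filter fun v => T.score v = T.score x ∧ T.inner v = T.inner y + 1 := by
    refine Finset.filter_congr fun v _ => and_congr_right fun hv => ?_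
    have := hin v hv
    omega
  rw [e] at hN
  omega

open scoped Classical in
/-- The classes met by a 3-cycle with exactly two scores have two vertices each, and no vertex of a
third class distinguishes these four vertices. The class of `z` again has two inner scores, so it
lies on such a cycle too, and the third vertex of that one must belong to the class of `x`. -/
theorem card_classes_of_cycle (hT : T.IsUnique) {x y z : V} (hxy : T.Adj x y) (hyz : T.Adj y z)
    (hzx : T.Adj z x) (h1 : T.score x = T.score y) (h2 : T.score z ≠ T.score x) :
    (Finset.univ.filter fun v => T.score v = T.score x).card = 2 ∧
    (Finset.univ.filter fun v => T.score v = T.score z).card = 2 ∧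
    ∀ c, T.score c ≠ T.score x → T.score c ≠ T.score z → ∀ v,
      (T.score v = T.score x ∨ T.score v = T.score z) → (T.Adj c v ↔ T.Adj c x) := by
  obtain ⟨r, hr, hri⟩ := exists_ne_score_eq hT hxy hyz hzx h1 h2
  obtain ⟨p, q, u, hp, hq, hu, hpq, hqu, hup⟩ := hT.exists_cycle hr hri
  rw [hr] at hp hq hu
  have h1' : T.score p = T.score q := hp.trans hq.symm
  have h2' : T.score u ≠ T.score p := hp ▸ hu
  have hux : T.score u = T.score x := by
    by_contra hne
    have hom : ∀ a, T.score a = T.score x → (T.Adj a r ↔ T.Adj a z) := by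
      intro a ha
      have ha1 : T.score a ≠ T.score p := by rw [ha, hp]; exact h2.symm
      have ha2 : T.score a ≠ T.score u := by rw [ha]; exact fun h => hne h.symm
      rw [adj_class_iff hT hpq hqu hup h1' h2' ha1 ha2 (hr.trans hp.symm),
        adj_class_iff hT hpq hqu hup h1' h2' ha1 ha2 hp.symm]
    have hyr := (hom y h1.symm).2 hyz
    have hrx : T.Adj r x := adj_of_not_adj (ne_of_score_ne (hr ▸ h2.symm)) fun h =>
      T.asymm _ _ hzx ((hom x rfl).1 h)
    exact hri (by rw [eq_of_adj_of_adj hT hxy hyz hzx h1 h2 hr hyr hrx])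
  refine ⟨?_, ?_, ?_⟩
  · exact card_class_eq_two hT hxy hyz hzx h1 h2 hux fun w hw hw' =>
      eq_of_inner_eq hT hpq hqu hup h1' h2' hw hw'
  · rw [← hp]
    exact card_class_eq_two hT hpq hqu hup h1' h2' hp.symm fun w hw hw' =>
      eq_of_inner_eq hT hxy hyz hzx h1 h2 hw hw'
  · rintro c hcx hcz v (hv | hv)
    · exact adj_class_iff hT hxy hyz hzx h1 h2 hcx hcz hv
    · have a1 := adj_class_iff hT hpq hqu hup h1' h2' (hp ▸ hcz) (hux ▸ hcx)
        (hv.trans hp.symm)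
      have a2 := adj_class_iff hT hpq hqu hup h1' h2' (hp ▸ hcz) (hux ▸ hcx) hp.symm
      have a3 := (hT.adj_cycle_iff hxy hyz hzx h1 h2 hcx hcz).2
      rw [a1, a3, a2]

/-- A tournament is strong if every proper nonempty set of its vertices wins some game against
the remaining ones. -/
def IsStrong {V : Type*} (T : Tournament V) : Prop :=
  ∀ X : Set V, X.Nonempty → (∀ v ∈ X, ∀ w ∉ X, ¬ T.Adj v w) → X = Set.univ

/-- In a strong tournament, a proper set of vertices that no outside vertex distinguishes lies on
3-cycles with two outside vertices. -/
theorem IsStrong.exists_cycle_of_module (hS : T.IsStrong) {M : Set V} (hne : M.Nonempty)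
    (hM : M ≠ Set.univ) (hmod : ∀ c ∉ M, ∀ v ∈ M, ∀ w ∈ M, T.Adj c v → T.Adj c w) :
    ∃ o i, o ∉ M ∧ i ∉ M ∧ T.Adj o i ∧ ∀ m ∈ M, T.Adj m o ∧ T.Adj i m := by
  obtain ⟨m, hm⟩ := hne
  by_contra hc
  have hout : ∀ c ∉ M, ¬ T.Adj m c → ∀ v ∈ M, T.Adj c v := fun c hcM h v hv =>
    hmod c hcM m hm v hv (adj_of_not_adj (by rintro rfl; exact hcM hm) h)
  have hin : ∀ c ∉ M, T.Adj m c → ∀ v ∈ M, T.Adj v c := fun c hcM h v hv =>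
    adj_of_not_adj (by rintro rfl; exact hcM hv) fun h' =>
      T.asymm _ _ h (hmod c hcM v hv m hm h')
  -- The outside vertices split into those beaten by `M` and those that beat `M`. If there are any of
  -- the first kind, one of them wins against one of the second kind, as `T` is strong.
  by_cases hO : ∃ o, o ∉ M ∧ T.Adj m o
  · have := hS {o | o ∉ M ∧ T.Adj m o} hO fun o ho i hi hoi => hc ?_
    · exact (this.symm ▸ Set.mem_univ m : m ∈ {o | o ∉ M ∧ T.Adj m o}).1 hm
    · have hiM : i ∉ M := fun h => T.asymm _ _ hoi (hin o ho.1 ho.2 i h)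
      exact ⟨o, i, ho.1, hiM, hoi, fun v hv =>
        ⟨hin o ho.1 ho.2 v hv, hout i hiM (fun h => hi ⟨hiM, h⟩) v hv⟩⟩
  · push Not at hO
    exact hM (hS M ⟨m, hm⟩ fun v hv w hw h => T.asymm _ _ h (hout w hw (hO w hw) v hv))

open scoped Classical in
/-- A strong unique tournament is regular, or it has just two score classes, of two vertices
each. -/
theorem IsStrong.score_eq_or_card_eq (hS : T.IsStrong) (hT : T.IsUnique) :
    (∀ v w, T.score v = T.score w) ∨
    ∃ x z, T.score x ≠ T.score z ∧
      (Finset.univ.filter fun v => T.score v = T.score x).card = 2 ∧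
      (Finset.univ.filter fun v => T.score v = T.score z).card = 2 ∧
      ∀ v, T.score v = T.score x ∨ T.score v = T.score z := by
  by_cases hcyc : ∃ x y z, T.Adj x y ∧ T.Adj y z ∧ T.Adj z x ∧ T.score x = T.score y ∧
      T.score z ≠ T.score x
  · obtain ⟨x, y, z, hxy, hyz, hzx, h1, h2⟩ := hcyc
    obtain ⟨hx, hz, hmod⟩ := card_classes_of_cycle hT hxy hyz hzx h1 h2
    refine Or.inr ⟨x, z, h2.symm, hx, hz, ?_⟩
    by_contra hall
    obtain ⟨o, i, ho, hi, hoi, hm⟩ := hS.exists_cycle_of_module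
      (M := {v | T.score v = T.score x ∨ T.score v = T.score z}) ⟨x, Or.inl rfl⟩
      (fun h => hall fun v => (h.symm ▸ Set.mem_univ v :
        v ∈ {v | T.score v = T.score x ∨ T.score v = T.score z}))
      (fun c hc v hv w hw h => by
        have hc' := not_or.1 hc
        rwa [hmod c hc'.1 hc'.2 w hw, ← hmod c hc'.1 hc'.2 v hv])
    have ho' := not_or.1 ho
    have hi' := not_or.1 hi
    obtain ⟨hxo, hix⟩ := hm x (Or.inl rfl)
    obtain ⟨hzo, hiz⟩ := hm z (Or.inr rfl)
    by_cases hs : T.score o = T.score i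
    · exact T.asymm _ _ hiz ((hT.adj_cycle_iff hoi hix hxo hs (Ne.symm ho'.1) (Ne.symm ho'.2) h2
        |>.1).1 hzo)
    · exact hT.not_rainbow hxo hoi hix (Ne.symm ho'.1) hs hi'.1
  · refine Or.inl fun v w => ?_
    have hinner : ∀ a b, T.score a = T.score b → T.inner a = T.inner b := by
      intro a b hab
      by_contra hi
      obtain ⟨x, y, z, hx, hy, hz, h⟩ := hT.exists_cycle hab hi
      exact hcyc ⟨x, y, z, h.1, h.2.1, h.2.2, hx.trans hy.symm, hx ▸ hz⟩
    by_contra hvw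
    obtain ⟨o, i, ho, hi, hoi, hm⟩ := hS.exists_cycle_of_module
      (M := {u | T.score u = T.score v}) ⟨v, rfl⟩
      (fun h => hvw (h.symm ▸ Set.mem_univ w : w ∈ {u | T.score u = T.score v}).symm)
      (fun c hc a ha b hb h => by
        have hab : T.score a = T.score b := Eq.trans ha hb.symm
        exact (hT.adj_iff' hab (hinner a b hab) (by rw [ha]; exact hc)).1 h)
    obtain ⟨hvo, hiv⟩ := hm v rfl
    by_cases hs : T.score o = T.score i
    · exact hcyc ⟨o, i, v, hoi, hiv, hvo, hs, fun h => ho h.symm⟩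
    · exact hT.not_rainbow hvo hoi hiv (fun h => ho h.symm) hs hi

end Tournament

/-! ### Regular tournaments -/

namespace Tournament

/-- The rotational tournament on `2 * m + 1` points of a circle: every point wins against the `m`
points that follow it. -/
def rotational (m : ℕ) : Tournament (Fin (2 * m + 1)) where
  Adj i j := (i.1 < j.1 ∧ j.1 ≤ i.1 + m) ∨ j.1 + m < i.1
  asymm i j := by omega
  total i j h := by
    have := Fin.val_ne_of_ne h
    omega

theorem score_rotational (m : ℕ) (i : Fin (2 * m + 1)) : (rotational m).score i = m := by
  classical
  obtain ⟨i, hi⟩ := i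
  rw [score_eq_sum]
  have h := Fin.sum_univ_eq_sum_range
    (fun j => if (i < j ∧ j ≤ i + m) ∨ j + m < i then 1 else 0) (2 * m + 1)
  replace h := h.trans (Finset.card_filter _ _).symm
  have e : ((Finset.range (2 * m + 1)).filter fun j => (i < j ∧ j ≤ i + m) ∨ j + m < i)
      = Finset.Ioc i (min (i + m) (2 * m)) ∪ Finset.range (i - m) := by
    ext j
    simp only [Finset.mem_filter, Finset.mem_range, Finset.mem_union, Finset.mem_Ioc]
    omega
  rw [e, Finset.card_union_of_disjoint, Nat.card_Ioc, Finset.card_range] at h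
  · refine Eq.trans ?_ (h.trans (by omega))
    exact Finset.sum_congr rfl fun j _ => if_congr Iff.rfl rfl rfl
  · refine Finset.disjoint_left.2 fun j hj hj' => ?_
    rw [Finset.mem_Ioc] at hj
    rw [Finset.mem_range] at hj'
    omega

/-- In a rotational tournament, the vertices beaten by one vertex are linearly ordered. -/
theorem rotational_not_adj (m : ℕ) {v x y z : Fin (2 * m + 1)} (hx : (rotational m).Adj v x)
    (hy : (rotational m).Adj v y) (hz : (rotational m).Adj v z) (hxy : (rotational m).Adj x y)
    (hyz : (rotational m).Adj y z) : ¬ (rotational m).Adj z x := by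
  simp only [rotational] at *
  omega

variable {V : Type*} [Fintype V] {T : Tournament V}

theorem scoreVector_of_forall_eq {m : ℕ} (h : ∀ v, T.score v = m) :
    T.scoreVector = Multiset.replicate (Fintype.card V) m := by
  rw [scoreVector, Multiset.map_congr rfl fun v _ => h v, Multiset.map_const', Finset.card_val,
    Finset.card_univ]

/-- A regular tournament on seven or more vertices is not unique: with one 3-cycle of the
rotational tournament reversed, one vertex wins against all vertices of another 3-cycle. -/
theorem IsUnique.lt_three_of_regular {m : ℕ} (hT : T.IsUnique) (h : ∀ v, T.score v = m)
    (hc : Fintype.card V = 2 * m + 1) : m < 3 := by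
  by_contra hm
  have hm' : 3 ≤ m := not_lt.1 hm
  have hR : (rotational m).IsUnique := hT.of_iso (hT.iso_of_scoreVector_eq (by
    rw [scoreVector_of_forall_eq h, scoreVector_of_forall_eq (score_rotational m), hc,
      Fintype.card_fin]))
  let p : (k : ℕ) → k < 2 * m + 1 → Fin (2 * m + 1) := fun k hk => ⟨k, hk⟩
  have h13 : (rotational m).Adj (p 1 (by omega)) (p 3 (by omega)) := by
    simp only [rotational, p]
    omega
  have h3m : (rotational m).Adj (p 3 (by omega)) (p (m + 3) (by omega)) := by
    simp only [rotational, p]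
    omega
  have hm1 : (rotational m).Adj (p (m + 3) (by omega)) (p 1 (by omega)) := by
    simp only [rotational, p]
    omega
  -- The reversal of `1 → 3 → m + 3 → 1` creates the 3-cycle `1 → 2 → 3 → 1` among the vertices
  -- beaten by `0`.
  obtain ⟨e⟩ := reverse_iso h13 h3m hm1 hR
  have key : ∀ i j : Fin (2 * m + 1), i.1 < j.1 → j.1 ≤ i.1 + m → ¬ (i.1 = 1 ∧ j.1 = 3) →
      ¬ i.1 = 3 → (rotational m).Adj (e i) (e j) := by
    intro i j h1 h2 h3 h4
    refine e.map_rel_iff.2 (Or.inl ⟨Or.inl ⟨h1, h2⟩, ?_⟩)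
    simp only [OnCycle, p, Fin.ext_iff]
    omega
  have h31 : (rotational m).Adj (e (p 3 (by omega))) (e (p 1 (by omega))) :=
    e.map_rel_iff.2 (Or.inr (Or.inl ⟨rfl, rfl⟩))
  refine rotational_not_adj m (v := e (p 0 (by omega))) (x := e (p 1 (by omega)))
    (y := e (p 2 (by omega))) (z := e (p 3 (by omega))) ?_ ?_ ?_ ?_ ?_ h31 <;>
  · refine key _ _ ?_ ?_ ?_ ?_ <;> simp only [p] <;> omega

theorem IsStrong.score_pos (hS : T.IsStrong) (hV : 1 < Fintype.card V) (v : V) :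
    0 < T.score v := by
  rw [Nat.pos_iff_ne_zero]
  intro h
  rw [score, Set.ncard_eq_zero] at h
  have hu := hS {v} ⟨v, rfl⟩ fun a ha w _ hw => by
    rw [Set.mem_singleton_iff] at ha
    subst ha
    exact (h ▸ hw : w ∈ (∅ : Set V))
  obtain ⟨w, hw⟩ := Fintype.exists_ne_of_one_lt_card hV v
  exact hw (hu.symm ▸ Set.mem_univ w : w ∈ ({v} : Set V))

theorem IsStrong.exists_scoreVector_eq [Nonempty V] (hS : T.IsStrong) (hT : T.IsUnique) :
    ∃ b : Basic, T.scoreVector = b.scores := by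
  classical
  have hsum := T.two_mul_sum_score
  rcases hS.score_eq_or_card_eq hT with h | ⟨x, z, hne, hx, hz, hall⟩
  · obtain ⟨v⟩ := ‹Nonempty V›
    have hreg : ∀ w, T.score w = T.score v := fun w => h w v
    rw [Finset.sum_congr rfl fun w _ => hreg w, Finset.sum_const, Finset.card_univ,
      smul_eq_mul, ← mul_assoc, mul_comm 2, mul_assoc] at hsum
    have hpos : 0 < Fintype.card V := Fintype.card_pos_iff.2 ⟨v⟩
    have hcard := Nat.eq_of_mul_eq_mul_left hpos hsum
    have hc : Fintype.card V = 2 * T.score v + 1 := by omega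
    have hlt := hT.lt_three_of_regular hreg hc
    rw [scoreVector_of_forall_eq hreg, hc]
    generalize T.score v = m at hlt
    interval_cases m
    exacts [⟨.b1, rfl⟩, ⟨.b3, rfl⟩, ⟨.b5, rfl⟩]
  · have hz' : (Finset.univ.filter fun v => ¬ T.score v = T.score x)
        = Finset.univ.filter fun v => T.score v = T.score z := by
      refine Finset.filter_congr fun v _ => ⟨(hall v).resolve_left, fun h h' => ?_⟩
      exact hne (h'.symm.trans h)
    have hcard : Fintype.card V = 4 := by
      rw [← Finset.card_univ, ← Finset.card_filter_add_card_filter_not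
        (fun v => T.score v = T.score x), hz', hx, hz]
    have hconst : ∀ s, (Finset.univ.filter fun v => T.score v = s).card = 2 →
        (Finset.univ.filter fun v => T.score v = s).val.map T.score
          = Multiset.replicate 2 s := by
      intro s hs
      rw [Multiset.map_congr rfl fun v hv => (Finset.mem_filter.1 hv).2, Multiset.map_const',
        Finset.card_val, hs]
    have hvec : T.scoreVector
        = Multiset.replicate 2 (T.score x) + Multiset.replicate 2 (T.score z) := by
      rw [← hconst _ hx, ← hconst _ hz, ← hz', scoreVector, ← Multiset.map_add,
        Finset.filter_val, Finset.filter_val, Multiset.filter_add_not]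
    have hs : 2 * (T.score x + T.score z) = 6 := by
      have : ∑ v, T.score v = 2 * (T.score x + T.score z) := by
        change T.scoreVector.sum = _
        rw [hvec]
        simp
        ring
      rw [hcard, this] at hsum
      omega
    have px := hS.score_pos (by omega) x
    have pz := hS.score_pos (by omega) z
    have hcases : (T.score x = 1 ∧ T.score z = 2) ∨ (T.score x = 2 ∧ T.score z = 1) := by
      omega
    refine ⟨.b4, ?_⟩
    rcases hcases with ⟨h1, h2⟩ | ⟨h1, h2⟩ <;> rw [hvec, h1, h2] <;> decide

end Tournament

/-! ### The basic tournaments -/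

namespace Tournament

variable {V : Type*} {T : Tournament V}

theorem score_eq_card_filter [Fintype V] (T : Tournament V) [DecidableRel T.Adj] (v : V) :
    T.score v = (Finset.univ.filter fun w => T.Adj v w).card := by
  classical
  rw [score, Set.ncard_eq_toFinset_card']
  congr 1
  ext w
  simp

theorem exists_of_score_eq_one {v : V} (h : T.score v = 1) : ∃ x, ∀ w, T.Adj v w ↔ w = x := by
  obtain ⟨x, hx⟩ := Set.ncard_eq_one.1 h
  exact ⟨x, fun w => by simpa using Set.ext_iff.1 hx w⟩

theorem exists_of_score_eq_two {v : V} (h : T.score v = 2) :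
    ∃ x y, T.Adj x y ∧ ∀ w, T.Adj v w ↔ w = x ∨ w = y := by
  obtain ⟨x, y, hxy, hs⟩ := Set.ncard_eq_two.1 h
  have hs' : ∀ w, T.Adj v w ↔ w = x ∨ w = y := fun w => by simpa using Set.ext_iff.1 hs w
  rcases T.total x y hxy with h' | h'
  · exact ⟨x, y, h', hs'⟩
  · exact ⟨y, x, h', fun w => (hs' w).trans or_comm⟩

end Tournament

namespace Basic

open Tournament

instance decidableRelAdj (b : Basic) : DecidableRel b.tournament.Adj :=
  match b with
  | b1 => fun _ _ => inferInstanceAs (Decidable False)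
  | b3 => fun (v w : Fin 3) => inferInstanceAs (Decidable (w = v + 1))
  | b4 => fun (v w : Fin 4) =>
    inferInstanceAs (Decidable (w = v + 1 ∨ (v = 0 ∧ w = 2) ∨ (v = 1 ∧ w = 3)))
  | b5 => fun (v w : Fin 5) => inferInstanceAs (Decidable (w = v + 1 ∨ w = v + 2))

theorem scoreVector_tournament (b : Basic) : b.tournament.scoreVector = b.scores := by
  rw [scoreVector, Multiset.map_congr rfl fun v _ => b.tournament.score_eq_card_filter v]
  cases b <;> decide

theorem isUnique_b3 : b3.tournament.IsUnique := by
  intro S hS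
  rw [scoreVector_tournament] at hS
  have hone : ∀ v, S.score v = 1 := by
    intro v
    have : S.score v ∈ S.scoreVector := Multiset.mem_map_of_mem _ (Finset.mem_univ v)
    rw [hS] at this
    simpa [scores] using this
  let a : Fin b3.size := (0 : Fin 3)
  obtain ⟨x, hx⟩ := exists_of_score_eq_one (hone a)
  obtain ⟨y, hy⟩ := exists_of_score_eq_one (hone x)
  have hax := (hx x).2 rfl
  have hxy := (hy y).2 rfl
  have hya : S.Adj y a := by
    refine adj_of_not_adj ?_ fun h => ?_
    · rintro rfl
      exact S.asymm _ _ hax hxy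
    · exact ne_of_adj hxy ((hx y).1 h).symm
  refine (iso_of_hom (S := b3.tournament) (T := S) (![a, x, y] : Fin 3 → Fin 3) ?_ le_rfl).symm
  intro (v : Fin 3) (w : Fin 3) (h : w = v + 1)
  subst h
  fin_cases v
  exacts [hax, hxy, hya]

theorem isUnique_b5 : b5.tournament.IsUnique := by
  intro S hS
  rw [scoreVector_tournament] at hS
  have htwo : ∀ v, S.score v = 2 := by
    intro v
    have : S.score v ∈ S.scoreVector := Multiset.mem_map_of_mem _ (Finset.mem_univ v)
    rw [hS] at this
    simpa [scores] using this
  let a : Fin b5.size := (0 : Fin 5)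
  obtain ⟨x, y, hxy, ha⟩ := exists_of_score_eq_two (htwo a)
  obtain ⟨z, w, hzw, hy⟩ := exists_of_score_eq_two (htwo y)
  have hax := (ha x).2 (Or.inl rfl)
  have hay := (ha y).2 (Or.inr rfl)
  have hyz := (hy z).2 (Or.inl rfl)
  have hyw := (hy w).2 (Or.inr rfl)
  have nza : z ≠ a := by rintro rfl; exact S.asymm _ _ hay hyz
  have nwa : w ≠ a := by rintro rfl; exact S.asymm _ _ hay hyw
  have nzx : z ≠ x := by rintro rfl; exact S.asymm _ _ hxy hyz
  have nwx : w ≠ x := by rintro rfl; exact S.asymm _ _ hxy hyw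
  have hza : S.Adj z a := adj_of_not_adj nza.symm fun h =>
    ((ha z).1 h).elim nzx (ne_of_adj hyz).symm
  have hwa : S.Adj w a := adj_of_not_adj nwa.symm fun h =>
    ((ha w).1 h).elim nwx (ne_of_adj hyw).symm
  -- `z` has its two wins already, and afterwards so has `x`
  have hxz : S.Adj x z := by
    refine adj_of_not_adj nzx fun h => ?_
    obtain ⟨p, q, -, hz⟩ := exists_of_score_eq_two (htwo z)
    have h1 := (hz x).1 h
    have h2 := (hz a).1 hza
    have h3 := (hz w).1 hzw
    have := ne_of_adj hax
    grind
  have hwx : S.Adj w x := by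
    refine adj_of_not_adj nwx.symm fun h => ?_
    obtain ⟨p, q, -, hx⟩ := exists_of_score_eq_two (htwo x)
    have h1 := (hx w).1 h
    have h2 := (hx y).1 hxy
    have h3 := (hx z).1 hxz
    have := ne_of_adj hzw
    have := ne_of_adj hyz
    have := ne_of_adj hyw
    grind
  refine (iso_of_hom (S := b5.tournament) (T := S) (![a, x, y, z, w] : Fin 5 → Fin 5) ?_
    le_rfl).symm
  intro (u : Fin 5) (v : Fin 5) (h : v = u + 1 ∨ v = u + 2)
  rcases h with rfl | rfl <;> fin_cases u
  exacts [hax, hxy, hyz, hzw, hwa, hay, hxz, hyw, hza, hwx]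

theorem isUnique_b4 : b4.tournament.IsUnique := by
  rw [isUnique_iff]
  intro (S : Tournament (Fin 4)) hS
  have hsc : ∀ v : Fin 4, S.score v = if v = 0 ∨ v = 1 then 2 else 1 := by
    intro v
    refine (hS v).trans ((score_eq_card_filter b4.tournament v).trans ?_)
    revert v
    decide
  obtain ⟨a, b, hab, hab'⟩ : ∃ a b : Fin 4, S.Adj a b ∧ (a = 0 ∧ b = 1 ∨ a = 1 ∧ b = 0) := by
    rcases S.total 0 1 (by decide) with h | h
    exacts [⟨0, 1, h, by simp⟩, ⟨1, 0, h, by simp⟩]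
  obtain ⟨c, d, hcd, hcd'⟩ : ∃ c d : Fin 4, S.Adj c d ∧ (c = 2 ∧ d = 3 ∨ c = 3 ∧ d = 2) := by
    rcases S.total 2 3 (by decide) with h | h
    exacts [⟨2, 3, h, by simp⟩, ⟨3, 2, h, by simp⟩]
  obtain ⟨hcov, nac, nad, sa, sb, sc⟩ : (∀ v, v = a ∨ v = b ∨ v = c ∨ v = d) ∧ a ≠ c ∧ a ≠ d ∧
      S.score a = 2 ∧ S.score b = 2 ∧ S.score c = 1 := by
    simp only [hsc]
    rcases hab' with ⟨rfl, rfl⟩ | ⟨rfl, rfl⟩ <;> rcases hcd' with ⟨rfl, rfl⟩ | ⟨rfl, rfl⟩ <;>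
      decide
  obtain ⟨p, q, hpq, hb⟩ := exists_of_score_eq_two sb
  have hp := (hb p).2 (Or.inl rfl)
  have hq := (hb q).2 (Or.inr rfl)
  have hbcd : S.Adj b c ∧ S.Adj b d := by
    have h1 := hcov p
    have h2 := hcov q
    have h3 := S.asymm _ _ hab
    have h4 := S.not_adj_self b
    have h5 := ne_of_adj hpq
    grind
  have hac : S.Adj a c := by
    refine adj_of_not_adj nac.symm fun h => ?_
    obtain ⟨r, hc⟩ := exists_of_score_eq_one sc
    exact nad (((hc a).1 h).trans ((hc d).1 hcd).symm)
  have hda : S.Adj d a := by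
    refine adj_of_not_adj nad fun h => ?_
    obtain ⟨r, s, -, ha⟩ := exists_of_score_eq_two sa
    have h1 := (ha b).1 hab
    have h2 := (ha c).1 hac
    have h3 := (ha d).1 h
    have := ne_of_adj hbcd.1
    have := ne_of_adj hbcd.2
    have := ne_of_adj hcd
    grind
  refine (iso_of_hom (S := b4.tournament) (T := S) (![a, b, c, d] : Fin 4 → Fin 4) ?_
    le_rfl).symm
  intro (u : Fin 4) (v : Fin 4) (h : v = u + 1 ∨ (u = 0 ∧ v = 2) ∨ (u = 1 ∧ v = 3))
  rcases h with rfl | ⟨rfl, rfl⟩ | ⟨rfl, rfl⟩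
  · fin_cases u
    exacts [hab, hbcd.1, hcd, hda]
  · exact hac
  · exact hbcd.2

theorem isUnique_tournament (b : Basic) : b.tournament.IsUnique := by
  cases b
  · exact fun S _ => (iso_of_hom id (fun _ _ h => h.elim) le_rfl : b1.tournament.Iso S).symm
  · exact isUnique_b3
  · exact isUnique_b4
  · exact isUnique_b5

end Basic

/-! ### Decomposition of unique tournaments -/

namespace Basic

open Tournament

theorem composition_cons (b : Basic) (l : List Basic) :
    (composition (b :: l)).Iso (b.tournament.sum (composition l)) :=
  (iso_relabel _ _).symm

theorem isUnique_composition (l : List Basic) : (composition l).IsUnique := by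
  induction l with
  | nil => exact fun S _ => iso_of_hom (fun v => v) (fun v => Fin.elim0 v) le_rfl
  | cons b l ih => exact ((isUnique_tournament b).sum ih).of_iso (composition_cons b l)

theorem composition_append (l l' : List Basic) :
    (composition (l ++ l')).Iso ((composition l).sum (composition l')) := by
  induction l with
  | nil =>
    have : IsEmpty (Fin (totalSize [])) := inferInstanceAs (IsEmpty (Fin 0))
    exact (sum_iso_of_isEmpty _ _).symm
  | cons b l ih =>
    exact (composition_cons b (l ++ l')).trans ((sum_congr (Iso.refl _) ih).trans
      ((sum_assoc _ _ _).symm.trans (sum_congr (composition_cons b l).symm (Iso.refl _))))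

theorem composition_singleton (b : Basic) : b.tournament.Iso (composition [b]) := by
  have : IsEmpty (Fin (totalSize [])) := inferInstanceAs (IsEmpty (Fin 0))
  refine Iso.trans ?_ (composition_cons b []).symm
  exact iso_of_hom Sum.inl (fun v w h => h) (by simp)

theorem scoreVector_composition_cons (b : Basic) (l : List Basic) :
    (composition (b :: l)).scoreVector
      = b.scores + (composition l).scoreVector.map (· + b.size) := by
  rw [(composition_cons b l).scoreVector_eq, scoreVector_sum, scoreVector_tournament,
    Fintype.card_fin]

theorem count_map_add_of_lt {a c : ℕ} (h : a < c) (m : Multiset ℕ) :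
    (m.map (· + c)).count a = 0 := by
  refine Multiset.count_eq_zero.2 fun hm => ?_
  obtain ⟨x, -, hx⟩ := Multiset.mem_map.1 hm
  omega

theorem scoreVector_composition_cons_ne_nil (b : Basic) (l : List Basic) :
    (composition (b :: l)).scoreVector ≠ (composition []).scoreVector := by
  intro h
  have h' := congrArg Multiset.card h
  rw [card_scoreVector, card_scoreVector, Fintype.card_fin, Fintype.card_fin, totalSize,
    totalSize] at h'
  cases b <;> simp [size] at h'

/-- The score vector of a composition determines its first constituent (by the numbers of scores
`0` and `1`) and the score vector of the remaining composition. -/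
theorem scoreVector_composition_injective :
    Function.Injective fun l : List Basic => (composition l).scoreVector := by
  intro l
  induction l with
  | nil =>
    intro l' h
    cases l' with
    | nil => rfl
    | cons b l' => exact absurd h.symm (scoreVector_composition_cons_ne_nil b l')
  | cons b l ih =>
    intro l' h
    cases l' with
    | nil => exact absurd h (scoreVector_composition_cons_ne_nil b l)
    | cons b' l' =>
      simp only [scoreVector_composition_cons] at h
      obtain rfl : b = b' := by
        have h0 := congrArg (Multiset.count 0) h
        have h1 := congrArg (Multiset.count 1) h
        rw [Multiset.count_add, Multiset.count_add,
          count_map_add_of_lt (by cases b <;> decide),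
          count_map_add_of_lt (by cases b' <;> decide)] at h0
        rw [Multiset.count_add, Multiset.count_add] at h1
        cases b <;> cases b' <;> first
          | rfl
          | exact absurd h0 (by decide)
          | rw [count_map_add_of_lt (by decide), count_map_add_of_lt (by decide)] at h1
            exact absurd h1 (by decide)
      rw [ih (Multiset.map_injective (add_left_injective b.size) (add_left_cancel h))]

/-- A minimal nonempty set of vertices without wins outside of it carries a strong tournament,
which is unique and therefore basic; it splits off as first constituent. -/
theorem exists_iso_composition {V : Type*} [Fintype V] {T : Tournament V} (hT : T.IsUnique) :
    ∃ l, T.Iso (composition l) := by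
  classical
  induction hn : Fintype.card V using Nat.strong_induction_on generalizing V with
  | _ n ih =>
  rcases isEmpty_or_nonempty V with hV | hV
  · exact ⟨[], (iso_of_hom (fun v => Fin.elim0 v) (fun v => Fin.elim0 v) (by simp)).symm⟩
  obtain ⟨X, ⟨hXne, hX⟩, hmin⟩ := (wellFounded_lt (α := Set V)).has_min
    {X | X.Nonempty ∧ ∀ v ∈ X, ∀ w ∉ X, ¬ T.Adj v w}
    ⟨Set.univ, Set.univ_nonempty, fun _ _ w hw => absurd (Set.mem_univ w) hw⟩
  set e : X ⊕ ↑Xᶜ ≃ V := Equiv.Set.sumCompl X with he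
  have hiso : (T.comap e e.injective).Iso T := ⟨⟨e, Iff.rfl⟩⟩
  have hsum := eq_sum_of_forall_not_adj (S := T.comap e e.injective) (by
    rintro ⟨v, hv⟩ ⟨w, hw⟩
    exact hX v hv w hw)
  set A := (T.comap e e.injective).comap Sum.inl Sum.inl_injective with hA
  set B := (T.comap e e.injective).comap Sum.inr Sum.inr_injective with hB
  have hu := hT.of_iso hiso
  rw [hsum] at hu hiso
  obtain ⟨hAu, hBu⟩ := hu.of_sum
  have hstrong : A.IsStrong := by
    rintro Y ⟨y, hy⟩ hY
    have hsub : Subtype.val '' Y ⊆ X := by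
      rintro _ ⟨v, -, rfl⟩
      exact v.2
    have hnlt := hmin (Subtype.val '' Y) ⟨⟨y.1, y, hy, rfl⟩, by
      rintro _ ⟨v, hv, rfl⟩ w hw h
      by_cases hwX : w ∈ X
      · exact hY v hv ⟨w, hwX⟩ (fun h' => hw ⟨_, h', rfl⟩) h
      · exact hX v v.2 w hwX h⟩
    refine Set.eq_univ_of_forall fun v => ?_
    have : X ⊆ Subtype.val '' Y := by
      by_contra hn
      exact hnlt ⟨hsub, hn⟩
    obtain ⟨v', hv', h⟩ := this v.2
    exact Subtype.ext h ▸ hv'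
  have : Nonempty X := hXne.to_subtype
  obtain ⟨b, hb⟩ := hstrong.exists_scoreVector_eq hAu
  have hAb : A.Iso b.tournament :=
    (isUnique_tournament b).iso_of_scoreVector_eq (hb.trans (scoreVector_tournament b).symm)
  have hlt : Fintype.card ↑Xᶜ < n := by
    have h1 := Fintype.card_congr e
    rw [Fintype.card_sum] at h1
    have h2 : 0 < Fintype.card X := Fintype.card_pos
    omega
  obtain ⟨l, hl⟩ := ih _ hlt hBu rfl
  exact ⟨b :: l, hiso.symm.trans ((sum_congr hAb hl).trans (composition_cons b l).symm)⟩

theorem existsUnique_iso_composition {V : Type*} [Fintype V] {T : Tournament V}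
    (hT : T.IsUnique) : ∃! l, T.Iso (composition l) := by
  obtain ⟨l, hl⟩ := exists_iso_composition hT
  exact ⟨l, hl, fun l' hl' =>
    scoreVector_composition_injective ((hl'.symm.trans hl).scoreVector_eq)⟩

end Basic

/-! ### Non-tracking strings -/

theorem exists_pattern_of_block (w : List Bool) (hl : w.length ≤ 5) (hc : 3 ≤ w.count true)
    (h : ∀ i < 4, w = w.take i ++ [false, false] ++ w.drop (i + 2) →
      ¬ (true ∈ w.take i ∧ true ∈ w.drop (i + 2))) :
    [true, true, true] <:+: w ∨ [true, false, true, true] <:+: w ∨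
      [true, true, false, true] <:+: w ∨ [true, false, true, false, true] <:+: w := by
  rcases w with _ | ⟨a, _ | ⟨b, _ | ⟨c, _ | ⟨d, _ | ⟨e, _ | ⟨f, w⟩⟩⟩⟩⟩⟩
  · revert hc; decide
  · revert a; decide
  · revert a b; decide
  · revert a b c; decide
  · revert a b c d; decide
  · revert a b c d e; decide
  · simp only [List.length_cons] at hl
    omega

theorem isTracking_of_pattern {p s : List Bool} (h : p <:+: s) (hl : p.length ≤ 5)
    (hc : 3 ≤ p.count true) (hf : ¬ [false, false] <:+: p) : IsTracking s :=
  ⟨p, h, hl, hc, fun a b he _ => hf ⟨a, b, he.symm⟩⟩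

/-- A string is tracking if and only if one of four patterns occurs in it: three detections, with
at most one non-detection between neighbours. -/
theorem isTracking_iff (s : List Bool) : IsTracking s ↔
    [true, true, true] <:+: s ∨ [true, false, true, true] <:+: s ∨
      [true, true, false, true] <:+: s ∨ [true, false, true, false, true] <:+: s := by
  constructor
  · rintro ⟨w, hw, hl, hc, h⟩
    exact (exists_pattern_of_block w hl hc fun i _ => h _ _).imp (·.trans hw)
      (·.imp (·.trans hw) (·.imp (·.trans hw) (·.trans hw)))
  · rintro (h | h | h | h)
    all_goals exact isTracking_of_pattern h (by decide) (by decide) (by decide)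

theorem isTracking_false_cons (s : List Bool) : IsTracking (false :: s) ↔ IsTracking s := by
  simp [isTracking_iff, List.infix_cons_iff]

namespace Basic

/-- The concatenation of basic strings. -/
def encode : List Basic → List Bool
  | [] => []
  | b :: l => b.string ++ encode l

theorem length_encode (l : List Basic) : (encode l).length = totalSize l := by
  induction l with
  | nil => rfl
  | cons b l ih =>
    rw [encode, List.length_append, ih, totalSize]
    cases b <;> rfl

theorem encode_append (l l' : List Basic) : encode (l ++ l') = encode l ++ encode l' := by
  induction l with
  | nil => rfl
  | cons b l ih => rw [List.cons_append, encode, encode, ih, List.append_assoc]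

theorem encode_singleton (b : Basic) : encode [b] = b.string := by
  rw [encode, encode, List.append_nil]

/-- A concatenation of basic strings does not start with `1` or `01`. -/
theorem encode_cases (l : List Basic) :
    encode l = [] ∨ encode l = [false] ∨ ∃ t, encode l = false :: false :: t := by
  cases l with
  | nil => exact Or.inl rfl
  | cons b l =>
    cases b with
    | b1 =>
      cases l with
      | nil => exact Or.inr (Or.inl rfl)
      | cons b l => cases b <;> exact Or.inr (Or.inr ⟨_, rfl⟩)
    | _ => exact Or.inr (Or.inr ⟨_, rfl⟩)

theorem isInitialLoss_encode (l : List Basic) : IsInitialLoss (encode l) := by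
  rcases encode_cases l with h | h | ⟨t, h⟩ <;> simp [h, IsInitialLoss]

/-- Detections from different basic strings are separated by two non-detections, and no basic
string has three detections. -/
theorem not_isTracking_encode (l : List Basic) : ¬ IsTracking (encode l) := by
  induction l with
  | nil => simp [isTracking_iff, encode]
  | cons b l ih =>
    rw [isTracking_iff] at ih ⊢
    rcases encode_cases l with h | h | ⟨t, h⟩ <;> rw [encode, h] <;> rw [h] at ih <;>
      cases b <;> simp [string, List.infix_cons_iff] at ih ⊢ <;> tauto

theorem encode_injective : Function.Injective encode := by
  intro l
  induction l with
  | nil =>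
    intro l' h
    cases l' with
    | nil => rfl
    | cons b l' => cases b <;> simp [encode, string] at h
  | cons b l ih =>
    intro l' h
    cases l' with
    | nil => cases b <;> simp [encode, string] at h
    | cons b' l' =>
      obtain rfl : b = b' := by
        rcases encode_cases l with h1 | h1 | ⟨t, h1⟩ <;>
          rcases encode_cases l' with h2 | h2 | ⟨t', h2⟩ <;>
          rw [encode, encode, h1, h2] at h <;> cases b <;> cases b' <;>
          first | rfl | simp [string] at h
      rw [ih (List.append_cancel_left h)]

/-- Reading a string from the left, the first basic string is determined by the zeros after
the first `1`. -/
theorem exists_encode_eq : ∀ s : List Bool, IsInitialLoss s → ¬ IsTracking s →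
    ∃ l, encode l = s
  | [], _, _ => ⟨[], rfl⟩
  | [false], _, _ => ⟨[b1], rfl⟩
  | true :: _, h, _ => absurd rfl h.1
  | false :: true :: _, h, _ => absurd rfl h.2
  | [false, false], _, _ => ⟨[b1, b1], rfl⟩
  | false :: false :: false :: t, _, h' => by
    obtain ⟨l, hl⟩ := exists_encode_eq (false :: false :: t) (by simp [IsInitialLoss])
      (by simpa only [isTracking_false_cons] using h')
    exact ⟨b1 :: l, congrArg _ hl⟩
  | [false, false, true], _, _ => ⟨[b3], rfl⟩
  | [false, false, true, false], _, _ => ⟨[b3, b1], rfl⟩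
  | false :: false :: true :: true :: t, _, h' => by
    obtain ⟨l, hl⟩ := exists_encode_eq t (by
        rw [isTracking_iff] at h'
        rcases t with _ | ⟨a, _ | ⟨b, t⟩⟩ <;>
          simp_all [IsInitialLoss, List.infix_cons_iff])
      (by
        rw [isTracking_iff] at h' ⊢
        simp only [List.infix_cons_iff] at h'
        tauto)
    exact ⟨b4 :: l, by rw [encode, hl]; rfl⟩
  | false :: false :: true :: false :: true :: t, _, h' => by
    obtain ⟨l, hl⟩ := exists_encode_eq t (by
        rw [isTracking_iff] at h'
        rcases t with _ | ⟨a, _ | ⟨b, t⟩⟩ <;>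
          simp_all [IsInitialLoss, List.infix_cons_iff])
      (by
        rw [isTracking_iff] at h' ⊢
        simp only [List.infix_cons_iff] at h'
        tauto)
    exact ⟨b5 :: l, by rw [encode, hl]; rfl⟩
  | false :: false :: true :: false :: false :: t, _, h' => by
    obtain ⟨l, hl⟩ := exists_encode_eq (false :: false :: t) (by simp [IsInitialLoss])
      (by
        rw [isTracking_iff] at h' ⊢
        simp only [List.infix_cons_iff] at h' ⊢
        tauto)
    exact ⟨b3 :: l, by rw [encode, hl]; rfl⟩
termination_by s => s.length

end Basic

theorem IsInitialLoss.eq_cons_cons_drop {s : List Bool} (h : IsInitialLoss s)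
    (hl : 2 ≤ s.length) : false :: false :: s.drop 2 = s := by
  rcases s with _ | ⟨a, _ | ⟨b, s⟩⟩
  · simp at hl
  · simp at hl
  · obtain ⟨ha, hb⟩ := h
    simp only [List.getElem?_cons_zero, List.getElem?_cons_succ, ne_eq, Option.some.injEq,
      Bool.not_eq_true] at ha hb
    rw [ha, hb]
    rfl

/-- Two initial zeros turn the non-tracking strings into the initial-loss ones. -/
def nonTrackingEquiv (k : ℕ) :
    {s : List Bool // s.length = k ∧ ¬ IsTracking s} ≃ ILString (k + 2) where
  toFun s := ⟨false :: false :: s.1, by simp [s.2.1], by simp [IsInitialLoss], by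
    simpa only [isTracking_false_cons] using s.2.2⟩
  invFun s := ⟨s.1.drop 2, by simp [s.2.1], by
    have h := s.2.2.2
    rwa [← s.2.2.1.eq_cons_cons_drop (by rw [s.2.1]; omega), isTracking_false_cons,
      isTracking_false_cons] at h⟩
  left_inv _ := rfl
  right_inv s := Subtype.ext (s.2.2.1.eq_cons_cons_drop (by rw [s.2.1]; omega))

/-! ### The bijection between unique tournaments and strings -/

open Basic in
/-- The basic constituents of an isomorphism class of unique tournaments. -/
def UniqueTournament.IsDecomposition {k : ℕ} (c : UniqueTournament k) (l : List Basic) : Prop :=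
  Quotient.liftOn c (fun T => T.1.Iso (composition l)) fun _ _ h =>
    propext ⟨fun h' => (Tournament.Iso.symm h).trans h', fun h' => Tournament.Iso.trans h h'⟩

namespace UniqueTournament

open Basic Tournament

variable {k : ℕ}

theorem existsUnique_isDecomposition (c : UniqueTournament k) :
    ∃! l, IsDecomposition c l := by
  induction c using Quotient.ind with
  | _ T => exact existsUnique_iso_composition T.2

theorem IsDecomposition.totalSize_eq {c : UniqueTournament k} {l : List Basic}
    (h : IsDecomposition c l) : totalSize l = k := by
  induction c using Quotient.ind with
  | _ T => simpa using (Iso.card_eq (S := T.1) (T := composition l) h).symm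

theorem IsDecomposition.eq {c d : UniqueTournament k} {l : List Basic}
    (hc : IsDecomposition c l) (hd : IsDecomposition d l) : c = d := by
  induction c using Quotient.ind with
  | _ S =>
    induction d using Quotient.ind with
    | _ T => exact Quotient.sound (Iso.trans hc (Iso.symm hd))

theorem isDecomposition_composition (l : List Basic) :
    IsDecomposition (isUnique_composition l).toClass l :=
  Iso.refl (composition l)

theorem isDecomposition_compose {m n : ℕ} {A : Tournament (Fin m)} {B : Tournament (Fin n)}
    {hA : A.IsUnique} {hB : B.IsUnique} {hAB : (A.compose B).IsUnique} {l l' : List Basic}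
    (h : IsDecomposition hA.toClass l) (h' : IsDecomposition hB.toClass l') :
    IsDecomposition hAB.toClass (l ++ l') :=
  (iso_relabel (A.sum B) finSumFinEquiv).symm.trans
    ((sum_congr h h').trans (composition_append l l').symm)

/-- The list of basic constituents. -/
noncomputable def decompose (c : UniqueTournament k) : List Basic :=
  (existsUnique_isDecomposition c).choose

theorem isDecomposition_decompose (c : UniqueTournament k) :
    IsDecomposition c (decompose c) :=
  (existsUnique_isDecomposition c).choose_spec.1

theorem decompose_eq {c : UniqueTournament k} {l : List Basic} (h : IsDecomposition c l) :
    decompose c = l :=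
  (existsUnique_isDecomposition c).unique (isDecomposition_decompose c) h

/-- Decompose a unique tournament and concatenate the corresponding basic strings. -/
noncomputable def stringEquiv (k : ℕ) : UniqueTournament k ≃ ILString k :=
  Equiv.ofBijective
    (fun c => ⟨encode (decompose c),
      (length_encode _).trans (isDecomposition_decompose c).totalSize_eq,
      isInitialLoss_encode _, not_isTracking_encode _⟩) (by
    constructor
    · intro c d h
      have h' := encode_injective (congrArg Subtype.val h)
      exact (isDecomposition_decompose c).eq (h' ▸ isDecomposition_decompose d)
    · rintro ⟨s, hl, hs, ht⟩
      obtain ⟨l, rfl⟩ := exists_encode_eq s hs ht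
      rw [length_encode] at hl
      subst hl
      exact ⟨_, Subtype.ext (congrArg encode (decompose_eq (isDecomposition_composition l)))⟩)

theorem stringEquiv_val {c : UniqueTournament k} {l : List Basic} (h : IsDecomposition c l) :
    (stringEquiv k c).1 = encode l :=
  congrArg encode (decompose_eq h)

end UniqueTournament

theorem mainTheorem2 :
    -- the two sequences agree, with a shift by two
    (∀ k : ℕ, NTr k = UT (k + 2)) ∧
    -- the basic tournaments have the stated score vectors
    (∀ b : Basic, b.tournament.scoreVector = b.scores) ∧
    -- every unique tournament decomposes, in one way only, into basic tournaments
    (∀ (k : ℕ) (T : Tournament (Fin k)), T.IsUnique →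
      ∃! l : List Basic, T.Iso (Basic.composition l)) ∧
    -- there is exactly one family of bijections that sends basic tournaments to basic strings and
    -- composition to concatenation
    (∃! φ : (k : ℕ) → UniqueTournament k ≃ ILString k,
      (∀ b : Basic, ∃ h : b.tournament.IsUnique, (φ b.size h.toClass).1 = b.string) ∧
      (∀ (m n : ℕ) (A : Tournament (Fin m)) (B : Tournament (Fin n))
        (hA : A.IsUnique) (hB : B.IsUnique), ∃ hAB : (A.compose B).IsUnique,
          (φ (m + n) hAB.toClass).1 = (φ m hA.toClass).1 ++ (φ n hB.toClass).1)) := by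
  refine ⟨fun k => ?_, Basic.scoreVector_tournament,
    fun k T hT => Basic.existsUnique_iso_composition hT,
    UniqueTournament.stringEquiv, ⟨fun b => ⟨Basic.isUnique_tournament b, ?_⟩, ?_⟩, ?_⟩
  · exact Nat.card_congr ((nonTrackingEquiv k).trans (UniqueTournament.stringEquiv (k + 2)).symm)
  · have h : (Basic.isUnique_tournament b).toClass.IsDecomposition [b] :=
      Basic.composition_singleton b
    rw [UniqueTournament.stringEquiv_val h, Basic.encode_singleton]
  · intro m n A B hA hB
    refine ⟨(hA.sum hB).of_iso (Tournament.iso_relabel _ _).symm, ?_⟩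
    have h := UniqueTournament.isDecomposition_decompose hA.toClass
    have h' := UniqueTournament.isDecomposition_decompose hB.toClass
    rw [UniqueTournament.stringEquiv_val h, UniqueTournament.stringEquiv_val h',
      UniqueTournament.stringEquiv_val (UniqueTournament.isDecomposition_compose h h'),
      Basic.encode_append]
  · rintro ψ ⟨hb, hsum⟩
    have key : ∀ l, (ψ _ (Basic.isUnique_composition l).toClass).1 = Basic.encode l := by
      intro l
      induction l with
      | nil => exact List.eq_nil_of_length_eq_zero (ψ 0 _).2.1
      | cons b l ih =>
        obtain ⟨h, hbs⟩ := hb b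
        obtain ⟨hc, hcs⟩ := hsum _ _ _ _ h (Basic.isUnique_composition l)
        rw [hbs, ih] at hcs
        exact hcs
    funext k
    refine Equiv.ext fun c => Subtype.ext ?_
    have hd := UniqueTournament.isDecomposition_decompose c
    rw [UniqueTournament.stringEquiv_val hd]
    generalize c.decompose = l at hd
    obtain rfl := hd.totalSize_eq
    rw [hd.eq (UniqueTournament.isDecomposition_composition l), key]
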